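/- **Theorem ($(X,Z)$-measurements are universal for one-way quantum computation).** *Definitions.* For a finite simple graph $G=(V,E)$, let $|G\rangle$ be the unique state with $X_uZ_{N(u)}|G\rangle=|G\rangle$ for all $u\in V$ and $\langle 0\cdots 0|G\rangle=2^{-|V|/2}$, and let $|G;S\rangle=Z_S|G\rangle$ for $S\subseteq V$. An open graph $(G,I,O)$ with $I,O\subseteq V$ and $|I|=|O|=n$ (both sets being enumerated) has the entangling operation $M:|x\rangle\mapsto 2^{-|I|/2}\sum_{S\subseteq I}(-1)^{x\cdot S}|G;S\rangle$ on $n$ qubits. A one-way computation on it applies $M$ to the input and then measures each qubit $v\notin O$ in a fixed one-qubit basis; whenever a measurement has outcome $1$, $X$ is applied to a prescribed set of output or not yet measured qubits and $Z$ to another such set. Measurements in the $(X,Z)$-plane are those of $\cos\theta\,Z+\sin\theta\,X$, i.e. in the basis $\{\cos\frac\theta2|0\rangle+\sin\frac\theta2|1\rangle,\ \sin\frac\theta2|0\rangle-\cos\frac\theta2|1\rangle\}$; $\theta=\pi/2$ is the $X$-measurement. Measurements in the $(X,Y)$-plane are those of $\cos\theta\,X+\sin\theta\,Y$. An open graph with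 chosen measurements simulates an $n$-qubit unitary $U$ if, for suitable such Pauli corrections, for every sequence of outcomes of its $k$ measurements the resulting map is $2^{-k/2}U$ up to a global phase. *Statement.* 1. For every $n$ and every real unitary (orthogonal) $2^n\times2^n$ matrix $U$, there is an open graph, with all non-output qubits measured in the $(X,Z)$-plane and all non-output input qubits $X$-measured, that simulates $U$. 2. Every path with an odd number of edges, with input its first vertex, output its last vertex and all other vertices than the last $X$-measured, simulates the Hadamard gate $H$. 3. The path with two vertices, both of which are inputs and outputs (so that nothing is measured), simulates $\Lambda Z:|x,y\rangle\mapsto(-1)^{xy}|x,y\rangle$. 4. For every real $\alpha$, let $P(\alpha)=\cos\frac\alpha2X+\sin\frac\alpha2Z$. The path $1,2,3,4,5$ with input $1$, output $5$ and vertices $1,2,3,4$ measured according to $X$, $Y$, $\cos\alpha\,X+\sin\alpha\,Y$, $Y$ simulates $P(\alpha)$. The graph obtained from this path by local complementation at its central vertex $3$ (which adds the edge $\{2,4\}$), with input $1$, output $5$, vertices $1,2,4$ measured according to $X$ and vertex $3$ according to $\cos\alpha\,X+\sin\alpha\,Z$, also simulates $P(\alpha)$. -/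

import Mathlib

namespace OneWay

/-! ### Qubit registers, Pauli operators, graph states -/

/-- (Unnormalised) pure states of a register of qubits indexed by `V`: amplitudes in the
computational basis `{|z⟩ : z ∈ {0,1}^V}`, with `true` standing for the bit `1`. -/
abbrev State (V : Type) := (V → Bool) → ℂ

/-- The sign `(-1)^b`. -/
def bitSign (b : Bool) : ℂ := if b then -1 else 1

/-- `X_A = ∏_{u ∈ A} X_u`, where `X : |b⟩ ↦ |1 - b⟩`. -/
def pauliX {V : Type} [DecidableEq V] (A : Finset V) (ψ : State V) : State V :=
  fun z => ψ (fun v => xor (z v) (decide (v ∈ A)))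

/-- `Z_A = ∏_{u ∈ A} Z_u`, where `Z : |b⟩ ↦ (-1)^b |b⟩`. -/
def pauliZ {V : Type} (A : Finset V) (ψ : State V) : State V :=
  fun z => (∏ v ∈ A, bitSign (z v)) * ψ z

/-- The neighbourhood of `u` as a finite set. -/
noncomputable def nbhd {V : Type} [Fintype V] (G : SimpleGraph V) (u : V) : Finset V :=
  (Set.toFinite (G.neighborSet u)).toFinset

/-- The graph state `|G⟩`: the amplitude at `z` is `(-1)^e / √(2^|V|)`, where `e` is the number of
edges of `G` both of whose ends carry the bit `1` in `z`. -/
noncomputable def graphState {V : Type} [Fintype V] (G : SimpleGraph V) : State V :=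
  fun z => (-1 : ℂ) ^ {e ∈ G.edgeSet | ∀ v ∈ e, z v = true}.ncard /
    ((Real.sqrt (2 ^ Fintype.card V) : ℝ) : ℂ)

theorem bitSign_mul_self (b : Bool) : bitSign b * bitSign b = 1 := by cases b <;> simp [bitSign]

theorem ncard_split {V : Type} [Fintype V] (G : SimpleGraph V) (u : V) (z : V → Bool)
    (hu : z u = true) :
    {e ∈ G.edgeSet | ∀ v ∈ e, z v = true}.ncard =
      {e ∈ G.edgeSet | ∀ v ∈ e, v ≠ u ∧ z v = true}.ncard +
        {v ∈ G.neighborSet u | z v = true}.ncard := by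
  classical
  have hinj : Function.Injective (fun v : V => s(u, v)) := by
    intro a b h
    exact Sym2.congr_right.1 h
  rw [← Set.ncard_image_of_injective {v ∈ G.neighborSet u | z v = true} hinj]
  rw [← Set.ncard_union_eq _ (Set.toFinite _) (Set.toFinite _)]
  · congr 1
    ext e
    induction e with
    | _ a b =>
      simp only [Set.mem_ofPred_eq, SimpleGraph.mem_edgeSet, Sym2.mem_iff, forall_eq_or_imp, forall_eq,
        Set.mem_union, Set.mem_image, SimpleGraph.mem_neighborSet, Sym2.eq_iff]
      constructor
      · rintro ⟨h, ha, hb⟩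
        by_cases h1 : a = u
        · right; exact ⟨b, ⟨h1 ▸ h, hb⟩, Or.inl ⟨h1.symm, rfl⟩⟩
        · by_cases h2 : b = u
          · right; exact ⟨a, ⟨h2 ▸ h.symm, ha⟩, Or.inr ⟨h2.symm, rfl⟩⟩
          · left; exact ⟨h, ⟨h1, ha⟩, ⟨h2, hb⟩⟩
      · rintro (⟨h, ⟨-, ha⟩, ⟨-, hb⟩⟩ | ⟨v, ⟨h, hv⟩, (⟨rfl, rfl⟩ | ⟨rfl, rfl⟩)⟩)
        · exact ⟨h, ha, hb⟩
        · exact ⟨h, hu, hv⟩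
        · exact ⟨h.symm, hv, hu⟩
  · rw [Set.disjoint_left]
    rintro e ⟨-, h⟩ ⟨v, -, rfl⟩
    exact (h u (by simp)).1 rfl

theorem prod_bitSign {V : Type} [Fintype V] (G : SimpleGraph V) (u : V) (z : V → Bool) :
    ∏ v ∈ nbhd G u, bitSign (z v) = (-1 : ℂ) ^ {v ∈ G.neighborSet u | z v = true}.ncard := by
  classical
  have : {v ∈ G.neighborSet u | z v = true} = ((nbhd G u).filter (fun v => z v = true) : Set V) := by
    ext v; simp [nbhd]
  rw [this, Set.ncard_coe_finset]
  simp [bitSign, Finset.prod_ite]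

/-- `|G⟩` is the only state which is fixed by `X_u Z_{N(u)}` for every vertex `u` and whose
amplitude at `0` is `1 / √(2^|V|)`. -/
theorem eq_graphState_iff {V : Type} [Fintype V] [DecidableEq V] (G : SimpleGraph V)
    (ψ : State V) :
    ψ = graphState G ↔ (∀ u, pauliX {u} (pauliZ (nbhd G u) ψ) = ψ) ∧
      ψ (fun _ => false) = 1 / ((Real.sqrt (2 ^ Fintype.card V) : ℝ) : ℂ) := by
  have hmem : ∀ u, u ∉ nbhd G u := by intro u; simp [nbhd]
  have key : ∀ u (z : V → Bool) (φ : State V), pauliX {u} (pauliZ (nbhd G u) φ) z =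
      (∏ v ∈ nbhd G u, bitSign (z v)) * φ (Function.update z u (!z u)) := by
    intro u z φ
    have h : (fun v => xor (z v) (decide (v ∈ ({u} : Finset V)))) =
        Function.update z u (!z u) := by
      ext v
      by_cases hv : v = u
      · subst hv; simp
      · simp [hv]
    unfold pauliX pauliZ
    rw [h]
    congr 1
    refine Finset.prod_congr rfl fun v hv => ?_
    rw [Function.update_of_ne]
    rintro rfl
    exact hmem _ hv
  have hsq : ∀ u (z : V → Bool), (∏ v ∈ nbhd G u, bitSign (z v)) *
      (∏ v ∈ nbhd G u, bitSign (z v)) = 1 := by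
    intro u z
    rw [← Finset.prod_mul_distrib]
    exact Finset.prod_eq_one fun v _ => bitSign_mul_self _
  have htrue : ∀ u (z : V → Bool), z u = true → graphState G z =
      (∏ v ∈ nbhd G u, bitSign (z v)) * graphState G (Function.update z u false) := by
    intro u z hz
    have h0 : {e ∈ G.edgeSet | ∀ v ∈ e, Function.update z u false v = true} =
        {e ∈ G.edgeSet | ∀ v ∈ e, v ≠ u ∧ z v = true} := by
      ext e
      simp only [Set.mem_ofPred_eq, Function.update_apply]
      refine and_congr_right fun _ => forall₂_congr fun v _ => ?_
      by_cases hv : v = u <;> simp [hv]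
    unfold graphState
    rw [prod_bitSign, ncard_split G u z hz, h0, pow_add]
    ring
  have hfix : ∀ u (z : V → Bool), graphState G z =
      (∏ v ∈ nbhd G u, bitSign (z v)) * graphState G (Function.update z u (!z u)) := by
    intro u z
    cases hz : z u
    · have h := htrue u (Function.update z u true) (by simp)
      have h2 : ∏ v ∈ nbhd G u, bitSign (Function.update z u true v) =
          ∏ v ∈ nbhd G u, bitSign (z v) := by
        refine Finset.prod_congr rfl fun v hv => ?_
        rw [Function.update_of_ne]
        rintro rfl
        exact hmem _ hv
      rw [h2, Function.update_idem, ← hz, Function.update_eq_self] at h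
      rw [hz] at *
      simp only [Bool.not_false]
      rw [h, ← mul_assoc, hsq, one_mul]
    · simpa using htrue u z hz
  have hzero : graphState G (fun _ => false) =
      1 / ((Real.sqrt (2 ^ Fintype.card V) : ℝ) : ℂ) := by
    have : {e ∈ G.edgeSet | ∀ v ∈ e, (fun _ : V => false) v = true} = ∅ := by
      refine Set.eq_empty_iff_forall_notMem.2 fun e he => ?_
      induction e with
      | _ a b => simpa using he.2 a (by simp)
    unfold graphState
    rw [this]
    simp
  constructor
  · rintro rfl
    exact ⟨fun u => funext fun z => by rw [key, ← hfix], hzero⟩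
  · rintro ⟨h1, h2⟩
    have hstep : ∀ (A : Finset V) (z : V → Bool), (∀ v, z v = true ↔ v ∈ A) →
        ψ z = graphState G z := by
      intro A
      induction A using Finset.induction_on with
      | empty =>
        intro z hz
        have : z = fun _ => false := by
          ext v
          have := hz v
          simpa using this
        rw [this, h2, hzero]
      | insert u A hu ih =>
        intro z hz
        have hzu : z u = true := (hz u).2 (Finset.mem_insert_self _ _)
        rw [← h1 u, key, hfix u, ih]
        intro v
        by_cases hv : v = u
        · subst hv; simp [hzu, hu]
        · simp [hv, hz]
    funext z
    exact hstep (Finset.univ.filter (fun v => z v = true)) z (by simp)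

/-- The signed graph state `|G;S⟩ = Z_S |G⟩`. -/
noncomputable def signedGraphState {V : Type} [Fintype V] (G : SimpleGraph V) (S : Finset V) :
    State V :=
  pauliZ S (graphState G)

/-! ### Measurements -/

/-- One-qubit measurement in a plane of the Bloch sphere, at a given angle.
`xz α` is the measurement of the observable `cos α Z + sin α X`;
`xy α` is the measurement of the observable `cos α X + sin α Y`. -/
inductive Measurement : Type
  | xz (α : ℝ) : Measurement
  | xy (α : ℝ) : Measurement

/-- The coordinate at `|b⟩` of the basis vector attached to the outcome `s` (`false` is the outcome
`0`, eigenvalue `1`; `true` is the outcome `1`, eigenvalue `-1`). In the `(X,Z)` plane: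
`|0^(α)⟩ = cos (α/2) |0⟩ + sin (α/2) |1⟩` and `|1^(α)⟩ = sin (α/2) |0⟩ - cos (α/2) |1⟩`.
In the `(X,Y)` plane: `(|0⟩ ± e^{iα} |1⟩) / √2`. -/
noncomputable def Measurement.ket : Measurement → Bool → Bool → ℂ
  | xz α, false, false => (Real.cos (α / 2) : ℂ)
  | xz α, false, true => (Real.sin (α / 2) : ℂ)
  | xz α, true, false => (Real.sin (α / 2) : ℂ)
  | xz α, true, true => -(Real.cos (α / 2) : ℂ)
  | xy _, _, false => 1 / ((Real.sqrt 2 : ℝ) : ℂ)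
  | xy α, s, true => bitSign s * Complex.exp (Complex.I * α) / ((Real.sqrt 2 : ℝ) : ℂ)

/-- The coordinate at `|b⟩` of the bra `⟨s|` of the measurement. -/
noncomputable def Measurement.bra (M : Measurement) (s b : Bool) : ℂ :=
  (starRingEnd ℂ) (M.ket s b)

/-- The `X`-measurement, in the basis `(|0⟩ ± |1⟩) / √2`. -/
noncomputable def measX : Measurement := Measurement.xz (Real.pi / 2)

/-- The measurement is in the `(X,Z)` plane. -/
def Measurement.IsXZ : Measurement → Prop
  | xz _ => True
  | xy _ => False

/-! ### One-way computations -/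

/-- An open graph `(G,I,O)` with `n` input and `n` output qubits (listed by `input` and `output`;
`I` and `O` may overlap), together with the measurement of each qubit. Only the qubits outside `O`
are measured: the value of `meas` at an output qubit is not used. -/
structure MeasuredOpenGraph (V : Type) (n : ℕ) where
  graph : SimpleGraph V
  input : Fin n ↪ V
  output : Fin n ↪ V
  meas : V → Measurement

/-- The entangling operation on the basis input `|x⟩`:
`|x⟩ ↦ 2^{-|I|/2} ∑_{S ⊆ I} (-1)^{x • S} |G;S⟩`. -/
noncomputable def MeasuredOpenGraph.entangle {V : Type} [Fintype V] {n : ℕ}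
    (P : MeasuredOpenGraph V n) (x : Fin n → Bool) : State V :=
  fun z => (1 / ((Real.sqrt (2 ^ n) : ℝ) : ℂ)) *
    ∑ S : Finset (Fin n), (∏ i ∈ S, bitSign (x i)) * signedGraphState P.graph (S.map P.input) z

/-- The measured (that is, non-output) qubits. -/
def MeasuredOpenGraph.measured {V : Type} [Fintype V] [DecidableEq V] {n : ℕ}
    (P : MeasuredOpenGraph V n) : Finset V :=
  Finset.univ.filter (fun v => v ∉ Finset.univ.map P.output)

/-- A correction strategy: when the measurement of the qubit `u` has outcome `1`, `X` is applied to
the qubits in `corrX u` and `Z` to the qubits in `corrZ u`. The qubit `u` is measured at time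
`time u`, and only qubits which are not yet measured (output qubits are never measured) may be
corrected. -/
structure CorrectionStrategy {V : Type} [Fintype V] [DecidableEq V] {n : ℕ}
    (P : MeasuredOpenGraph V n) where
  time : V → ℕ
  corrX : V → Finset V
  corrZ : V → Finset V
  unmeasured : ∀ u ∈ P.measured, ∀ v ∈ corrX u ∪ corrZ u, v ∈ P.measured → time u < time v

/-- The qubits to which an odd number of the corrections described by `corr` is applied, when the
outcomes of the measurements are given by `s`. -/
def MeasuredOpenGraph.corrected {V : Type} [Fintype V] [DecidableEq V] {n : ℕ}
    (P : MeasuredOpenGraph V n) (corr : V → Finset V) (s : V → Bool) : Finset V :=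
  Finset.univ.filter (fun v => Odd (P.measured.filter (fun u => s u = true ∧ v ∈ corr u)).card)

/-- The linear map performed by the computation when the outcomes of the measurements are given by
`s` (whose values at output qubits are not used), without re-normalisation: entangle, correct, and
apply the bras of the measured qubits. Corrections act on unmeasured qubits only, hence commute with
the measurements performed before them, so that on every qubit all corrections come first; the order
of the `X` and `Z` corrections matters for a global sign only. -/
noncomputable def MeasuredOpenGraph.branch {V : Type} [Fintype V] [DecidableEq V] {n : ℕ}
    (P : MeasuredOpenGraph V n) (C : CorrectionStrategy P) (s : V → Bool) :
    Matrix (Fin n → Bool) (Fin n → Bool) ℂ :=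
  fun y x => ∑ z : V → Bool, if (fun i => z (P.output i)) = y then
      (∏ v ∈ P.measured, (P.meas v).bra (s v) (z v)) *
        pauliX (P.corrected C.corrX s) (pauliZ (P.corrected C.corrZ s) (P.entangle x)) z
    else 0

/-- The measured open graph simulates `U`: for some correction strategy, whatever the outcomes of
the measurements are, the computation performs `U` up to a global phase, every sequence of outcomes
having the same probability. -/
def MeasuredOpenGraph.Simulates {V : Type} [Fintype V] [DecidableEq V] {n : ℕ}
    (P : MeasuredOpenGraph V n) (U : Matrix (Fin n → Bool) (Fin n → Bool) ℂ) : Prop :=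
  ∃ C : CorrectionStrategy P, ∀ s : V → Bool, ∃ c : ℂ, ‖c‖ = 1 ∧
    ((Real.sqrt (2 ^ P.measured.card) : ℝ) : ℂ) • P.branch C s = c • U

/-- All measurements are in the `(X,Z)` plane, and the measured input qubits are `X`-measured. -/
def MeasuredOpenGraph.IsXZ {V : Type} [Fintype V] [DecidableEq V] {n : ℕ}
    (P : MeasuredOpenGraph V n) : Prop :=
  (∀ v ∈ P.measured, (P.meas v).IsXZ) ∧
    ∀ i, P.input i ∈ P.measured → P.meas (P.input i) = measX

/-! ### Gates -/

/-- The one-qubit gate with a given `2 × 2` real matrix. -/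
noncomputable def gate1 (A : Matrix (Fin 2) (Fin 2) ℝ) :
    Matrix (Fin 1 → Bool) (Fin 1 → Bool) ℂ :=
  fun y x => (A (if y 0 then 1 else 0) (if x 0 then 1 else 0) : ℂ)

/-- The Hadamard gate. -/
noncomputable def gateH : Matrix (Fin 1 → Bool) (Fin 1 → Bool) ℂ :=
  gate1 ((1 / Real.sqrt 2) • !![1, 1; 1, -1])

/-- `P(α) = cos (α/2) X + sin (α/2) Z`. -/
noncomputable def gateP (α : ℝ) : Matrix (Fin 1 → Bool) (Fin 1 → Bool) ℂ :=
  gate1 (Real.cos (α / 2) • !![0, 1; 1, 0] + Real.sin (α / 2) • !![1, 0; 0, -1])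

/-- `ΛZ : |x,y⟩ ↦ (-1)^{xy} |x,y⟩`. -/
def gateCZ : Matrix (Fin 2 → Bool) (Fin 2 → Bool) ℂ :=
  Matrix.diagonal (fun x => bitSign (x 0 && x 1))

/-! ### Gadgets -/

/-- Local complementation `G * u`: edges and non-edges between distinct neighbours of `u` are
exchanged. -/
def localComplement {V : Type} (G : SimpleGraph V) (u : V) : SimpleGraph V where
  Adj a b := a ≠ b ∧ Xor (G.Adj a b) (G.Adj u a ∧ G.Adj u b)
  symm := ⟨fun a b h => ⟨h.1.symm, by simpa only [G.adj_comm b a, and_comm] using h.2⟩⟩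
  loopless := ⟨fun _ h => h.1 rfl⟩

/-- A path with `m` edges; the first vertex is the input, the last one is the output, all vertices
but the last are `X`-measured. -/
noncomputable def pathX (m : ℕ) : MeasuredOpenGraph (Fin (m + 1)) 1 where
  graph := SimpleGraph.pathGraph (m + 1)
  input := ⟨fun _ => 0, fun _ _ _ => Subsingleton.elim _ _⟩
  output := ⟨fun _ => Fin.last m, fun _ _ _ => Subsingleton.elim _ _⟩
  meas _ := measX

/-- The path with two vertices, both being input and output; nothing is measured. -/
noncomputable def edgeCZ : MeasuredOpenGraph (Fin 2) 2 where
  graph := SimpleGraph.pathGraph 2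
  input := Function.Embedding.refl _
  output := Function.Embedding.refl _
  meas _ := measX

/-- The standard `(X,Y)`-pattern: a path with five vertices, from the input to the output, the first
four being measured according to `X`, `Y`, `cos α X + sin α Y` and `Y`. -/
noncomputable def pathXY (α : ℝ) : MeasuredOpenGraph (Fin 5) 1 where
  graph := SimpleGraph.pathGraph 5
  input := ⟨fun _ => 0, fun _ _ _ => Subsingleton.elim _ _⟩
  output := ⟨fun _ => 4, fun _ _ _ => Subsingleton.elim _ _⟩
  meas := ![.xy 0, .xy (Real.pi / 2), .xy α, .xy (Real.pi / 2), .xy 0]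

/-- The triangle gadget: the path with five vertices locally complemented at its central vertex. The
central vertex is measured according to `cos α X + sin α Z` and the other ones, except the output,
according to `X`. -/
noncomputable def triangleXZ (α : ℝ) : MeasuredOpenGraph (Fin 5) 1 where
  graph := localComplement (SimpleGraph.pathGraph 5) 2
  input := ⟨fun _ => 0, fun _ _ _ => Subsingleton.elim _ _⟩
  output := ⟨fun _ => 4, fun _ _ _ => Subsingleton.elim _ _⟩
  meas := ![measX, measX, .xz (Real.pi / 2 - α), measX, measX]

end OneWay

set_option linter.unusedSectionVars false

namespace OneWay

/-! ### Signs, edge toggling, Pauli operators -/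

/-! Patterns are grown by three moves on their outputs: preparing a fresh vertex, adding an edge
between two outputs, and measuring an output. `Realizes` keeps the invariant that Pauli corrections
make every branch equal to the same map up to a phase independent of the input. A fresh isolated
vertex is harmless. An edge is a controlled `Z`, which turns a pending `X` on one end into that `X`
together with a `Z` on the other (`Realizes.entangle`). A measurement is allowed when a Pauli
operator on the remaining outputs carries its branch of outcome 1 to that of outcome 0
(`Realizes.measure`). With unnormalised amplitudes all constants match the normalisation in
`Simulates` (`simulates_of_realizes`).

Linking an output to a fresh vertex and measuring it teleports its qubit. An `X`-measurement yields
the Hadamard gate, which settles odd paths, since `H² = 1`; the measurements of the `(X,Y)` path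
give `P(α)` up to a phase. For the triangle, two such links, each combined with an edge to an
ancilla, produce `HZHZ = XZ` controlled by the ancilla. Measuring the ancilla in the `(X,Z)` plane
then gives `cos (θ/2) + sin (θ/2) XZ`, and because `(XZ)² = -1` the Pauli operator `XZ` corrects the
outcome 1 (`Realizes.rotate`). Together with a first Hadamard link this is exactly the triangle
gadget.

For universality, conjugating a rotation of a wire by controlled `Z` negates its angle according to
another bit. Averaging over signs gives rotations whose angle is any function of the other bits
(`isRealizable_mux`). These bring every real vector onto a coordinate axis, so every reflection is
conjugate to the sign change of one basis vector, which is obtained by rotating an idle ancilla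
through `π` (`isRealizable_householder`). Reflections generate the orthogonal group
(`orthogonal_induction`). -/

theorem bitSign_xor (a b : Bool) : bitSign (xor a b) = bitSign a * bitSign b := by
  cases a <;> cases b <;> simp [bitSign]

theorem norm_bitSign (b : Bool) : ‖bitSign b‖ = 1 := by cases b <;> simp [bitSign]

/-- `(-1)^e`, where `e` is the number of edges of `G` with both ends carrying the bit `1`. -/
noncomputable def edgeSign {V : Type} (G : SimpleGraph V) (z : V → Bool) : ℂ :=
  (-1 : ℂ) ^ {e ∈ G.edgeSet | ∀ v ∈ e, z v = true}.ncard

/-- The graph obtained by adding or removing the edge `ab`. -/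
def toggleEdge {V : Type} (G : SimpleGraph V) (a b : V) : SimpleGraph V where
  Adj x y := x ≠ y ∧ Xor (G.Adj x y) (s(x, y) = s(a, b))
  symm := ⟨fun x y h => ⟨h.1.symm, by simpa only [G.adj_comm y x, Sym2.eq_swap (a := y)] using h.2⟩⟩
  loopless := ⟨fun _ h => h.1 rfl⟩

theorem mem_edgeSet_toggleEdge {V : Type} (G : SimpleGraph V) {a b : V} (hab : a ≠ b)
    (e : Sym2 V) : e ∈ (toggleEdge G a b).edgeSet ↔ Xor (e ∈ G.edgeSet) (e = s(a, b)) := by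
  induction e with
  | _ x y =>
    simp only [SimpleGraph.mem_edgeSet, toggleEdge, and_iff_right_iff_imp]
    rintro (h | h) rfl
    · exact G.loopless.irrefl _ h.1
    · have := h.1
      rw [Sym2.eq_iff] at this
      rcases this with ⟨h1, h2⟩ | ⟨h1, h2⟩
      · exact hab (h1.symm.trans h2)
      · exact hab (h2.symm.trans h1)

/-- The number of counted edges changes by one exactly when both ends carry the bit 1, whether the
edge is added or removed. Toggling an edge is therefore a controlled `Z`. -/
theorem edgeSign_toggleEdge {V : Type} [Fintype V] (G : SimpleGraph V) {a b : V} (hab : a ≠ b)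
    (z : V → Bool) :
    edgeSign (toggleEdge G a b) z = edgeSign G z * bitSign (z a && z b) := by
  classical
  unfold edgeSign
  by_cases hz : z a = true ∧ z b = true
  · have hb : bitSign (z a && z b) = -1 := by simp [bitSign, hz.1, hz.2]
    rw [hb]
    by_cases hadj : G.Adj a b
    · have : {e ∈ G.edgeSet | ∀ v ∈ e, z v = true} =
          insert s(a, b) {e ∈ (toggleEdge G a b).edgeSet | ∀ v ∈ e, z v = true} := by
        ext e
        simp only [Set.mem_insert_iff, Set.mem_ofPred_eq, mem_edgeSet_toggleEdge G hab]
        by_cases he : e = s(a, b)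
        · subst he; simp [hadj, hz.1, hz.2]
        · simp [he, Xor]
      rw [this, Set.ncard_insert_of_notMem _ (Set.toFinite _), pow_succ]
      · ring
      · simp only [Set.mem_ofPred_eq, mem_edgeSet_toggleEdge G hab, SimpleGraph.mem_edgeSet]
        simp [hadj, Xor]
    · have : {e ∈ (toggleEdge G a b).edgeSet | ∀ v ∈ e, z v = true} =
          insert s(a, b) {e ∈ G.edgeSet | ∀ v ∈ e, z v = true} := by
        ext e
        simp only [Set.mem_insert_iff, Set.mem_ofPred_eq, mem_edgeSet_toggleEdge G hab]
        by_cases he : e = s(a, b)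
        · subst he; simp [hadj, hz.1, hz.2]
        · simp [he, Xor]
      rw [this, Set.ncard_insert_of_notMem _ (Set.toFinite _), pow_succ]
      simp [hadj]
  · have hb : bitSign (z a && z b) = 1 := by
      have : (z a && z b) = false := by
        rw [Bool.eq_false_iff]; simpa using hz
      simp [bitSign, this]
    rw [hb, mul_one]
    congr 2
    ext e
    simp only [Set.mem_ofPred_eq, mem_edgeSet_toggleEdge G hab]
    by_cases he : e = s(a, b)
    · subst he
      simp only [Sym2.mem_iff, forall_eq_or_imp, forall_eq, hz, and_false]
    · simp [he, Xor]

theorem edgeSign_map {V W : Type} (j : V ↪ W) (G : SimpleGraph V) (z : W → Bool) :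
    edgeSign (G.map j) z = edgeSign G (z ∘ j) := by
  unfold edgeSign
  have : {e ∈ (G.map j).edgeSet | ∀ v ∈ e, z v = true} =
      Sym2.map j '' {e ∈ G.edgeSet | ∀ v ∈ e, (z ∘ j) v = true} := by
    ext e
    simp only [SimpleGraph.edgeSet_map, Set.mem_ofPred_eq, Set.mem_image]
    constructor
    · rintro ⟨⟨e, he, rfl⟩, h⟩
      exact ⟨e, ⟨he, fun v hv => h _ (Sym2.mem_map.2 ⟨v, hv, rfl⟩)⟩, rfl⟩
    · rintro ⟨e, ⟨he, h⟩, rfl⟩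
      refine ⟨⟨e, he, rfl⟩, fun v hv => ?_⟩
      obtain ⟨u, hu, rfl⟩ := Sym2.mem_map.1 hv
      exact h u hu
  rw [this, Set.ncard_image_of_injective _ (Sym2.map.injective j.injective)]

/-- The bits of `z`, flipped on `A`. -/
def flip {V : Type} [DecidableEq V] (A : Finset V) (z : V → Bool) : V → Bool :=
  fun v => xor (z v) (decide (v ∈ A))

theorem pauliX_apply {V : Type} [DecidableEq V] (A : Finset V) (ψ : State V) (z : V → Bool) :
    pauliX A ψ z = ψ (flip A z) := rfl

theorem flip_symmDiff {V : Type} [DecidableEq V] (A B : Finset V) (z : V → Bool) :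
    flip (symmDiff A B) z = flip A (flip B z) := by
  funext v
  by_cases h1 : v ∈ A <;> by_cases h2 : v ∈ B <;> simp [flip, Finset.mem_symmDiff, h1, h2]

theorem flip_flip {V : Type} [DecidableEq V] (A : Finset V) (z : V → Bool) :
    flip A (flip A z) = z := by
  rw [← flip_symmDiff]; funext v; simp [flip]

theorem flip_empty {V : Type} [DecidableEq V] (z : V → Bool) : flip ∅ z = z := by
  funext v; simp [flip]

/-- `∏_{v ∈ A} (-1)^{z_v}`. -/
noncomputable def signOn {V : Type} (A : Finset V) (z : V → Bool) : ℂ := ∏ v ∈ A, bitSign (z v)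

theorem pauliZ_apply {V : Type} (A : Finset V) (ψ : State V) (z : V → Bool) :
    pauliZ A ψ z = signOn A z * ψ z := rfl

theorem norm_signOn {V : Type} (A : Finset V) (z : V → Bool) : ‖signOn A z‖ = 1 := by
  simp [signOn, norm_prod, norm_bitSign]

theorem signOn_mul_self {V : Type} (A : Finset V) (z : V → Bool) :
    signOn A z * signOn A z = 1 := by
  rw [signOn, ← Finset.prod_mul_distrib]
  exact Finset.prod_eq_one fun v _ => bitSign_mul_self _

/-- Vertices in the intersection contribute the square of a sign. -/
theorem signOn_symmDiff {V : Type} [DecidableEq V] (A B : Finset V) (z : V → Bool) :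
    signOn (symmDiff A B) z = signOn A z * signOn B z := by
  have h : ∀ C D : Finset V, signOn C z = signOn (C \ D) z * signOn (C ∩ D) z := by
    intro C D
    rw [signOn, signOn, signOn, mul_comm, Finset.prod_inter_mul_prod_sdiff]
  have hu : signOn (symmDiff A B) z = signOn (A \ B) z * signOn (B \ A) z := by
    rw [signOn, symmDiff_def, Finset.sup_eq_union, Finset.prod_union]
    · rfl
    · exact disjoint_sdiff_sdiff
  rw [hu, h A B, h B A, Finset.inter_comm B A]
  have := signOn_mul_self (A ∩ B) z
  linear_combination (-(signOn (A \ B) z * signOn (B \ A) z)) * this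

/-- This is the commutation of `X_A` and `Z_B` up to a sign: the first factor does not depend on
`z`, so it only changes the global phase. -/
theorem signOn_flip {V : Type} [DecidableEq V] (A B : Finset V) (z : V → Bool) :
    signOn B (flip A z) = signOn B (fun v => decide (v ∈ A)) * signOn B z := by
  simp only [signOn, flip, bitSign_xor, Finset.prod_mul_distrib, mul_comm]

theorem signOn_map {V W : Type} (j : V ↪ W) (A : Finset V) (z : W → Bool) :
    signOn (A.map j) z = signOn A (z ∘ j) := by
  simp [signOn]

theorem flip_map_comp {V W : Type} [DecidableEq V] [DecidableEq W] (j : V ↪ W) (A : Finset V)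
    (z : W → Bool) : flip (A.map j) z ∘ j = flip A (z ∘ j) := by
  funext v; simp [flip]

/-! ### Accumulated corrections -/

/-- The elements `v` which lie in `corr u` for an odd number of `u ∈ M` with `s u = 1`. -/
def oddSet {V : Type} [Fintype V] [DecidableEq V] (M : Finset V) (corr : V → Finset V)
    (s : V → Bool) : Finset V :=
  Finset.univ.filter (fun v => Odd (M.filter (fun u => s u = true ∧ v ∈ corr u)).card)

/-- Parity written as a sum over `ZMod 2`, which makes accumulated corrections additive in the
strategy. -/
theorem mem_oddSet {V : Type} [Fintype V] [DecidableEq V] (M : Finset V) (corr : V → Finset V)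
    (s : V → Bool) (v : V) : v ∈ oddSet M corr s ↔
      ∑ u ∈ M, (if s u = true ∧ v ∈ corr u then 1 else 0 : ZMod 2) = 1 := by
  rw [oddSet, Finset.mem_filter, Finset.sum_boole, ← ZMod.natCast_eq_one_iff_odd]
  simp

theorem zmod_two_ite (p q : Prop) [Decidable p] [Decidable q] [Decidable (Xor p q)] :
    (if Xor p q then 1 else 0 : ZMod 2) = (if p then 1 else 0) + (if q then 1 else 0) := by
  by_cases p <;> by_cases q <;> (simp [*]; try decide)

theorem zmod_two_add_eq_one (a b : ZMod 2) : a + b = 1 ↔ Xor (a = 1) (b = 1) := by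
  revert a b; decide

theorem oddSet_symmDiff {V : Type} [Fintype V] [DecidableEq V] (M : Finset V)
    (F G : V → Finset V) (s : V → Bool) :
    oddSet M (fun u => symmDiff (F u) (G u)) s = symmDiff (oddSet M F s) (oddSet M G s) := by
  classical
  ext v
  rw [Finset.mem_symmDiff, mem_oddSet, mem_oddSet, mem_oddSet]
  have := zmod_two_add_eq_one (∑ u ∈ M, (if s u = true ∧ v ∈ F u then 1 else 0 : ZMod 2))
    (∑ u ∈ M, (if s u = true ∧ v ∈ G u then 1 else 0 : ZMod 2))
  rw [← Finset.sum_add_distrib] at this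
  refine Iff.trans (Eq.congr (Finset.sum_congr rfl fun u _ => ?_) rfl) this
  rw [← zmod_two_ite]
  refine if_congr ?_ rfl rfl
  rw [Finset.mem_symmDiff, Xor]
  tauto

/-- Used for the edge `ab`: whenever a strategy applies `X` to `a`, the modified one also applies
`Z` to `b`, and the accumulated `Z` depends only on the accumulated `X` at `a`. -/
theorem oddSet_transfer {V : Type} [Fintype V] [DecidableEq V] (M : Finset V)
    (F : V → Finset V) (s : V → Bool) (a b : V) :
    oddSet M (fun u => if a ∈ F u then {b} else ∅) s = if a ∈ oddSet M F s then {b} else ∅ := by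
  ext v
  rw [mem_oddSet]
  by_cases hv : v = b
  · subst hv
    have : ∀ u, v ∈ (if a ∈ F u then {v} else ∅ : Finset V) ↔ a ∈ F u := by
      intro u; split_ifs with h <;> simp [h]
    simp only [this]
    rw [← mem_oddSet]
    split_ifs with h <;> simp [h]
  · have : ∀ u, v ∉ (if a ∈ F u then {b} else ∅ : Finset V) := by
      intro u; split_ifs with h <;> simp [hv]
    simp only [this, and_false, if_false, Finset.sum_const_zero]
    split_ifs <;> simp [hv]

theorem oddSet_insert_update {V : Type} [Fintype V] [DecidableEq V] (M : Finset V)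
    (F : V → Finset V) (s : V → Bool) (o : V) (ho : o ∉ M) (D : Finset V) :
    oddSet (insert o M) (Function.update F o D) s =
      if s o = true then symmDiff D (oddSet M F s) else oddSet M F s := by
  have hM : ∀ v, ∑ u ∈ M, (if s u = true ∧ v ∈ Function.update F o D u then 1 else 0 : ZMod 2) =
      ∑ u ∈ M, (if s u = true ∧ v ∈ F u then 1 else 0 : ZMod 2) := by
    intro v
    refine Finset.sum_congr rfl fun u hu => ?_
    rw [Function.update_of_ne (by rintro rfl; exact ho hu)]
  ext v
  rw [mem_oddSet, Finset.sum_insert ho, hM, Function.update_self]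
  by_cases hs : s o = true
  · rw [if_pos hs, Finset.mem_symmDiff, mem_oddSet, zmod_two_add_eq_one]
    simp [hs, Xor]
  · rw [if_neg hs, mem_oddSet]
    simp [hs]

theorem oddSet_map {V W : Type} [Fintype V] [DecidableEq V] [Fintype W] [DecidableEq W]
    (j : V ↪ W) (M : Finset V) (F : V → Finset V) (F' : W → Finset W)
    (hF : ∀ u, F' (j u) = (F u).map j) (s : W → Bool) :
    oddSet (M.map j) F' s = (oddSet M F (s ∘ j)).map j := by
  ext w
  rw [mem_oddSet, Finset.sum_map]
  simp only [hF]
  by_cases hw : ∃ v, j v = w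
  · obtain ⟨v, rfl⟩ := hw
    simp only [Finset.mem_map' j]
    rw [mem_oddSet]; rfl
  · have : ∀ A : Finset V, w ∉ A.map j := by
      intro A h
      obtain ⟨v, -, hv⟩ := Finset.mem_map.1 h
      exact hw ⟨v, hv⟩
    simp [this]

end OneWay

namespace OneWay

/-! ### Patterns with an arbitrary register of outputs -/

/-- An open graph with `n` inputs and outputs indexed by `κ`, and the measurement of each vertex. -/
@[ext]
structure Pattern (V : Type) (n : ℕ) (κ : Type) where
  graph : SimpleGraph V
  input : Fin n ↪ V
  output : κ ↪ V
  meas : V → Measurement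

namespace Pattern

variable {V κ κ' : Type} [Fintype V] [DecidableEq V] [Fintype κ] [DecidableEq κ]
  [Fintype κ'] [DecidableEq κ'] {n m : ℕ}

/-- The non-output vertices. -/
def measured (P : Pattern V n κ) : Finset V :=
  Finset.univ.filter (fun v => v ∉ Finset.univ.map P.output)

theorem mem_measured (P : Pattern V n κ) (v : V) : v ∈ P.measured ↔ ∀ k, P.output k ≠ v := by
  simp [measured]

/-- The entangled state for the basis input `x`, unnormalised. -/
noncomputable def amp (P : Pattern V n κ) (x : Fin n → Bool) : State V :=
  fun z => if z ∘ P.input = x then edgeSign P.graph z else 0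

/-- Application of the bras of the measured vertices, for the outcomes `s`. -/
noncomputable def readout (P : Pattern V n κ) (s : V → Bool) (ψ : State V) : State κ :=
  fun y => ∑ z : V → Bool, if z ∘ P.output = y then
    (∏ v ∈ P.measured, (P.meas v).bra (s v) (z v)) * ψ z else 0

/-- The state of the outputs for the outcomes `s`, after the corrections. -/
noncomputable def run (P : Pattern V n κ) (corrX corrZ : V → Finset V) (s : V → Bool)
    (x : Fin n → Bool) : State κ :=
  P.readout s (pauliX (oddSet P.measured corrX s) (pauliZ (oddSet P.measured corrZ s) (P.amp x)))

/-- With suitable corrections, the pattern maps the basis input `x` to `A x` up to a global phase,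
whatever the outcomes are. -/
def Realizes (P : Pattern V n κ) (A : (Fin n → Bool) → State κ) : Prop :=
  ∃ (time : V → ℕ) (corrX corrZ : V → Finset V),
    (∀ u ∈ P.measured, ∀ v ∈ corrX u ∪ corrZ u, v ∈ P.measured → time u < time v) ∧
    ∀ s, ∃ c : ℂ, ‖c‖ = 1 ∧ ∀ x, P.run corrX corrZ s x = c • A x

theorem readout_smul (P : Pattern V n κ) (s : V → Bool) (c : ℂ) (ψ : State V) :
    P.readout s (c • ψ) = c • P.readout s ψ := by
  funext y
  simp only [readout, Pi.smul_apply, smul_eq_mul, Finset.mul_sum]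
  refine Finset.sum_congr rfl fun z _ => ?_
  split_ifs <;> ring

/-- The measurements are in the `(X,Z)` plane, measured inputs are `X`-measured, and the outputs
in `F` are not inputs. -/
def XZ (P : Pattern V n κ) (F : Set κ) : Prop :=
  (∀ v ∈ P.measured, (P.meas v).IsXZ) ∧
    (∀ i, P.input i ∈ P.measured → P.meas (P.input i) = measX) ∧
    ∀ k ∈ F, ∀ i, P.input i ≠ P.output k

/-! ### Entangling two outputs -/

/-- The pattern which applies a controlled `Z` to two outputs. -/
def entangle (P : Pattern V n κ) (a b : κ) : Pattern V n κ :=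
  { P with graph := toggleEdge P.graph (P.output a) (P.output b) }

/-- The controlled `Z` operation. -/
noncomputable def cz (a b : κ) (ψ : State κ) : State κ := fun y => bitSign (y a && y b) * ψ y

theorem signOn_ite_singleton (p : Prop) [Decidable p] (b : V) (z : V → Bool) :
    signOn (if p then {b} else ∅) z = bitSign (decide p && z b) := by
  by_cases p <;> simp [signOn, bitSign, *]

/-- Controlled `Z` normalises the Pauli group: it takes `X_a` to `X_a Z_b`. Adding the matching `Z`
corrections lets the new edge move past all corrections. -/
theorem Realizes.entangle {P : Pattern V n κ} {A : (Fin n → Bool) → State κ} (h : P.Realizes A)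
    {a b : κ} (hab : a ≠ b) : (P.entangle a b).Realizes (fun x => cz a b (A x)) := by
  obtain ⟨time, corrX, corrZ, htime, hrun⟩ := h
  have hne : P.output a ≠ P.output b := fun h => hab (P.output.injective h)
  have hmeas : (P.entangle a b).measured = P.measured := rfl
  set T : V → Finset V := fun u => symmDiff (if P.output a ∈ corrX u then {P.output b} else ∅)
    (if P.output b ∈ corrX u then {P.output a} else ∅) with hT
  refine ⟨time, corrX, fun u => symmDiff (corrZ u) (T u), ?_, ?_⟩
  -- The additional corrections touch outputs only, so they impose no condition on the order of
  -- measurements.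
  · intro u hu v hv hvm
    rw [hmeas] at hu hvm
    refine htime u hu v ?_ hvm
    have hva : P.output a ≠ v := (P.mem_measured v).1 hvm a
    have hvb : P.output b ≠ v := (P.mem_measured v).1 hvm b
    have hvT : v ∉ T u := by
      simp only [hT, Finset.mem_symmDiff]
      split_ifs <;> simp [hva.symm, hvb.symm]
    rw [Finset.mem_union, Finset.mem_symmDiff] at hv
    rw [Finset.mem_union]
    tauto
  · intro s
    obtain ⟨c, hc, hrun⟩ := hrun s
    set B := oddSet P.measured corrX s with hB
    set C := oddSet P.measured corrZ s with hC
    -- When both ends are flipped, `X_a X_b` passes the controlled `Z` at the price of one more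
    -- sign, independent of `z` and of the input.
    set ε : ℂ := bitSign (decide (P.output a ∈ B) && decide (P.output b ∈ B)) with hε
    have hC' : oddSet P.measured (fun u => symmDiff (corrZ u) (T u)) s =
        symmDiff C (symmDiff (if P.output a ∈ B then {P.output b} else ∅)
          (if P.output b ∈ B then {P.output a} else ∅)) := by
      rw [oddSet_symmDiff, hT, oddSet_symmDiff, oddSet_transfer, oddSet_transfer]
    refine ⟨ε * c, by rw [norm_mul, hε, norm_bitSign, hc, one_mul], fun x => ?_⟩
    have hstate : ∀ z, pauliX B (pauliZ (symmDiff C (symmDiff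
        (if P.output a ∈ B then {P.output b} else ∅)
          (if P.output b ∈ B then {P.output a} else ∅))) ((P.entangle a b).amp x)) z =
        ε * bitSign (z (P.output a) && z (P.output b)) * pauliX B (pauliZ C (P.amp x)) z := by
      intro z
      have hamp : (P.entangle a b).amp x (flip B z) = P.amp x (flip B z) *
          bitSign (flip B z (P.output a) && flip B z (P.output b)) := by
        simp only [amp, Pattern.entangle, edgeSign_toggleEdge P.graph hne, ite_mul, zero_mul]
      rw [pauliX_apply, pauliX_apply, pauliZ_apply, pauliZ_apply, signOn_symmDiff, signOn_symmDiff,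
        signOn_ite_singleton, signOn_ite_singleton, hamp]
      have key : bitSign (decide (P.output a ∈ B) && flip B z (P.output b)) *
          bitSign (decide (P.output b ∈ B) && flip B z (P.output a)) *
          bitSign (flip B z (P.output a) && flip B z (P.output b)) =
          ε * bitSign (z (P.output a) && z (P.output b)) := by
        simp only [hε, flip]
        generalize decide (P.output a ∈ B) = p
        generalize decide (P.output b ∈ B) = q
        generalize z (P.output a) = r
        generalize z (P.output b) = t
        cases p <;> cases q <;> cases r <;> cases t <;> simp [bitSign]
      linear_combination (signOn C (flip B z) * P.amp x (flip B z)) * key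
    have := hrun x
    rw [run, hmeas, hC']
    funext y
    have hy := congrFun this y
    simp only [run, readout, Pi.smul_apply, smul_eq_mul] at hy ⊢
    rw [mul_assoc, cz, mul_left_comm c, ← hy, Finset.mul_sum, Finset.mul_sum]
    refine Finset.sum_congr rfl fun z _ => ?_
    rw [hstate]
    by_cases hz : z ∘ P.output = y
    · have hz' : z ∘ (P.entangle a b).output = y := hz
      rw [if_pos hz, if_pos hz', ← hz]
      simp only [Function.comp_apply]
      have : ∏ v ∈ (P.entangle a b).measured, ((P.entangle a b).meas v).bra (s v) (z v) =
        ∏ v ∈ P.measured, (P.meas v).bra (s v) (z v) := rfl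
      rw [this]
      ring
    · have hz' : ¬ z ∘ (P.entangle a b).output = y := hz
      rw [if_neg hz, if_neg hz', mul_zero, mul_zero]

theorem XZ.entangle {P : Pattern V n κ} {F : Set κ} (h : P.XZ F) (a b : κ) :
    (P.entangle a b).XZ F := h

/-! ### Preparing a fresh output -/

/-- The pattern with a fresh isolated vertex, which is an output and not an input. -/
def prepare (P : Pattern (Fin m) n κ) (M : Measurement) : Pattern (Fin (m + 1)) n (Option κ) where
  graph := P.graph.map Fin.castSuccEmb
  input := P.input.trans Fin.castSuccEmb
  output := ⟨fun k => k.elim (Fin.last m) (fun k => (P.output k).castSucc), by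
    rintro (_ | k) (_ | l) h
    · rfl
    · exact absurd h.symm (Fin.castSucc_ne_last _)
    · exact absurd h (Fin.castSucc_ne_last _)
    · exact congrArg some (P.output.injective (Fin.castSucc_injective _ h))⟩
  meas := Fin.snoc P.meas M

theorem prepare_output_none (P : Pattern (Fin m) n κ) (M : Measurement) :
    (P.prepare M).output none = Fin.last m := rfl

theorem prepare_output_some (P : Pattern (Fin m) n κ) (M : Measurement) (k : κ) :
    (P.prepare M).output (some k) = (P.output k).castSucc := rfl

theorem measured_prepare (P : Pattern (Fin m) n κ) (M : Measurement) :
    (P.prepare M).measured = P.measured.map Fin.castSuccEmb := by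
  ext v
  rw [mem_measured]
  refine Fin.lastCases ?_ (fun v => ?_) v
  · constructor
    · intro h; exact absurd rfl (h none)
    · intro h; simp at h
  · rw [← Fin.coe_castSuccEmb, Finset.mem_map', mem_measured, Option.forall]
    simp [prepare_output_none, prepare_output_some, (Fin.castSucc_ne_last v).symm]

theorem XZ.prepare {P : Pattern (Fin m) n κ} {F : Set κ} (h : P.XZ F) (M : Measurement) :
    (P.prepare M).XZ (insert none (some '' F)) := by
  obtain ⟨h1, h2, h3⟩ := h
  refine ⟨?_, ?_, ?_⟩
  · intro v hv
    rw [measured_prepare] at hv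
    obtain ⟨v, hv', rfl⟩ := Finset.mem_map.1 hv
    simpa [Pattern.prepare] using h1 v hv'
  · intro i hi
    rw [measured_prepare] at hi
    have : P.input i ∈ P.measured := (Finset.mem_map' Fin.castSuccEmb).1 hi
    simpa [Pattern.prepare] using h2 i this
  · rintro k (rfl | ⟨k, hk, rfl⟩) i
    · exact Fin.castSucc_ne_last _
    · exact fun h => h3 k hk i (Fin.castSucc_injective _ h)

theorem sum_snoc {M : Type} [AddCommMonoid M] (f : (Fin (m + 1) → Bool) → M) :
    ∑ z, f z = ∑ b : Bool, ∑ z : Fin m → Bool, f (Fin.snoc z b) := by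
  rw [← Fintype.sum_prod_type' (f := fun b (z : Fin m → Bool) => f (Fin.snoc z b))]
  exact (Equiv.sum_comp (Fin.snocEquiv (fun _ => Bool)) f).symm

theorem snoc_comp_castSuccEmb (z : Fin m → Bool) (b : Bool) :
    (Fin.snoc z b : Fin (m + 1) → Bool) ∘ Fin.castSuccEmb = z := by
  funext i; simp

/-- The fresh vertex has no edge, so it is in the unnormalised state `|0⟩ + |1⟩` and the amplitudes
do not depend on its bit. -/
theorem Realizes.prepare {P : Pattern (Fin m) n κ} {A : (Fin n → Bool) → State κ}
    (h : P.Realizes A) (M : Measurement) :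
    (P.prepare M).Realizes (fun x y => A x (y ∘ some)) := by
  obtain ⟨time, corrX, corrZ, htime, hrun⟩ := h
  have hmeas := P.measured_prepare M
  set corrX' : Fin (m + 1) → Finset (Fin (m + 1)) :=
    Fin.snoc (fun u => (corrX u).map Fin.castSuccEmb) ∅ with hX'
  set corrZ' : Fin (m + 1) → Finset (Fin (m + 1)) :=
    Fin.snoc (fun u => (corrZ u).map Fin.castSuccEmb) ∅ with hZ'
  have hX : ∀ u, corrX' (Fin.castSuccEmb u) = (corrX u).map Fin.castSuccEmb := by
    intro u; simp [hX']
  have hZ : ∀ u, corrZ' (Fin.castSuccEmb u) = (corrZ u).map Fin.castSuccEmb := by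
    intro u; simp [hZ']
  -- The time given to the fresh vertex is immaterial, because it is an output.
  refine ⟨Fin.snoc time 0, corrX', corrZ', ?_, ?_⟩
  · rw [hmeas]
    intro u hu v hv hvm
    obtain ⟨u, hu', rfl⟩ := Finset.mem_map.1 hu
    obtain ⟨v, hvm', rfl⟩ := Finset.mem_map.1 hvm
    rw [hX, hZ, Finset.mem_union, Finset.mem_map', Finset.mem_map'] at hv
    simpa using htime u hu' v (Finset.mem_union.2 hv) hvm'
  · intro s
    obtain ⟨c, hc, hrun⟩ := hrun (s ∘ Fin.castSuccEmb)
    refine ⟨c, hc, fun x => ?_⟩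
    funext y
    have hy := congrFun (hrun x) (y ∘ some)
    simp only [Pi.smul_apply] at hy ⊢
    rw [← hy]
    simp only [run, readout, hmeas]
    rw [oddSet_map _ _ corrX _ hX, oddSet_map _ _ corrZ _ hZ, sum_snoc]
    -- The bit of the fresh output is prescribed by `y`, so only one value contributes.
    rw [Finset.sum_eq_single (y none)]
    · refine Finset.sum_congr rfl fun z _ => ?_
      have hout : (Fin.snoc z (y none) : Fin (m + 1) → Bool) ∘ (P.prepare M).output = y ↔
          z ∘ P.output = y ∘ some := by
        rw [funext_iff, funext_iff, Option.forall]
        simp [prepare_output_none, prepare_output_some]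
      refine if_congr hout ?_ rfl
      congr 1
      · rw [Finset.prod_map]
        refine Finset.prod_congr rfl fun v _ => ?_
        simp [Pattern.prepare]
      · rw [pauliX_apply, pauliX_apply, pauliZ_apply, pauliZ_apply, signOn_map, flip_map_comp,
          snoc_comp_castSuccEmb]
        congr 1
        simp only [amp, Pattern.prepare, edgeSign_map, flip_map_comp, snoc_comp_castSuccEmb]
        have : ∀ w : Fin (m + 1) → Bool, w ∘ (P.input.trans Fin.castSuccEmb) =
          (w ∘ Fin.castSuccEmb) ∘ P.input := fun w => rfl
        rw [this, flip_map_comp, snoc_comp_castSuccEmb]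
    · intro b _ hb
      refine Finset.sum_eq_zero fun z _ => if_neg fun h => hb ?_
      have := congrFun h none
      simpa [prepare_output_none] using this
    · simp

/-! ### Measuring an output -/

/-- The pattern in which the output `k` is measured and the outputs in the range of `f` remain. -/
def measure (P : Pattern V n κ) (f : κ' ↪ κ) (k : κ) (M : Measurement) : Pattern V n κ' :=
  { P with
    output := f.trans P.output
    meas := Function.update P.meas (P.output k) M }

/-- The bra `β` applied to the qubit `k`, when the qubits in the range of `f` remain. -/
noncomputable def contract (f : κ' ↪ κ) (k : κ) (β : Bool → ℂ) (ψ : State κ) : State κ' :=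
  fun y => ∑ w : κ → Bool, if w ∘ f = y then β (w k) * ψ w else 0

/-- Once the bits of the remaining wires are fixed, only the bit of `k` is free; `g b` is the
assignment in which it equals `b`. -/
theorem contract_apply {f : κ' ↪ κ} {k : κ}
    (hf : ∀ l, l = k ∨ ∃ l', f l' = l) (β : Bool → ℂ) (ψ : State κ) (y : κ' → Bool)
    (g : Bool → κ → Bool) (hg : ∀ b, g b ∘ f = y) (hgk : ∀ b, g b k = b) :
    contract f k β ψ y = ∑ b, β b * ψ (g b) := by
  rw [contract, ← Finset.sum_filter]
  refine Finset.sum_bij' (fun w _ => w k) (fun b _ => g b) (by simp) (by simp [hg]) ?_ ?_ ?_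
  · intro w hw
    rw [Finset.mem_filter] at hw
    funext l
    rcases hf l with rfl | ⟨l', rfl⟩
    · rw [hgk]
    · have h1 := congrFun (hg (w k)) l'
      have h2 := congrFun hw.2 l'
      exact h1.trans h2.symm
  · intro b _; exact hgk b
  · intro w hw
    rw [Finset.mem_filter] at hw
    congr 2
    funext l
    rcases hf l with rfl | ⟨l', rfl⟩
    · rw [hgk]
    · have h1 := congrFun (hg (w k)) l'
      have h2 := congrFun hw.2 l'
      exact h2.trans h1.symm

theorem measured_measure (P : Pattern V n κ) (f : κ' ↪ κ) {k : κ} (M : Measurement)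
    (hf : ∀ l, l = k ∨ ∃ l', f l' = l) (hk : ∀ l', f l' ≠ k) :
    (P.measure f k M).measured = insert (P.output k) P.measured := by
  ext v
  rw [Finset.mem_insert, mem_measured, mem_measured]
  constructor
  · intro h
    by_cases hv : v = P.output k
    · exact Or.inl hv
    · refine Or.inr fun l => ?_
      rcases hf l with rfl | ⟨l', rfl⟩
      · exact fun h => hv h.symm
      · exact h l'
  · rintro (rfl | h) l
    · exact fun h => hk l (P.output.injective h)
    · exact h (f l)

/-- The set `F` records the outputs known not to be inputs: these may be measured at any angle, the
others only according to `X`. -/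
theorem XZ.measure {P : Pattern V n κ} {F : Set κ} (h : P.XZ F) (f : κ' ↪ κ) {k : κ}
    {M : Measurement} (hf : ∀ l, l = k ∨ ∃ l', f l' = l) (hk : ∀ l', f l' ≠ k)
    (hM : M.IsXZ) (hMk : M = measX ∨ k ∈ F) : (P.measure f k M).XZ (f ⁻¹' F) := by
  obtain ⟨h1, h2, h3⟩ := h
  refine ⟨?_, ?_, fun l hl i => h3 (f l) hl i⟩
  · intro v hv
    rw [measured_measure P f M hf hk, Finset.mem_insert] at hv
    by_cases hvk : v = P.output k
    · subst hvk; simpa [Pattern.measure] using hM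
    · simpa [Pattern.measure, Function.update_of_ne hvk] using h1 v (hv.resolve_left hvk)
  · intro i hi
    rw [measured_measure P f M hf hk, Finset.mem_insert] at hi
    change P.input i = _ ∨ P.input i ∈ _ at hi
    change Function.update P.meas (P.output k) M (P.input i) = measX
    by_cases hvk : P.input i = P.output k
    · rw [hvk, Function.update_self]
      exact hMk.resolve_right fun hkF => h3 k hkF i hvk
    · rw [Function.update_of_ne hvk]
      exact h2 i (hi.resolve_left hvk)

theorem readout_measure (P : Pattern V n κ) (f : κ' ↪ κ) {k : κ} (M : Measurement)
    (hf : ∀ l, l = k ∨ ∃ l', f l' = l) (hk : ∀ l', f l' ≠ k) (s : V → Bool) (ψ : State V) :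
    (P.measure f k M).readout s ψ =
      contract f k (M.bra (s (P.output k))) (P.readout s ψ) := by
  have ho : P.output k ∉ P.measured := fun h => (P.mem_measured _).1 h k rfl
  funext y
  simp only [readout, contract, measured_measure P f M hf hk]
  have : ∀ w : κ → Bool, (if w ∘ f = y then M.bra (s (P.output k)) (w k) *
      ∑ z : V → Bool, (if z ∘ P.output = w then
        (∏ v ∈ P.measured, (P.meas v).bra (s v) (z v)) * ψ z else 0) else 0) =
      ∑ z : V → Bool, if z ∘ P.output = w then (if w ∘ f = y then M.bra (s (P.output k)) (w k) *
        ((∏ v ∈ P.measured, (P.meas v).bra (s v) (z v)) * ψ z) else 0) else 0 := by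
    intro w
    split_ifs with h
    · rw [Finset.mul_sum]
      refine Finset.sum_congr rfl fun z _ => ?_
      split_ifs <;> simp
    · simp
  simp only [this]
  rw [Finset.sum_comm]
  refine Finset.sum_congr rfl fun z _ => ?_
  rw [Finset.sum_ite_eq Finset.univ (z ∘ P.output), if_pos (Finset.mem_univ _),
    Finset.prod_insert ho]
  refine if_congr Iff.rfl ?_ rfl
  rw [mul_assoc]
  congr 1
  · simp [Pattern.measure]
  · congr 1
    refine Finset.prod_congr rfl fun v hv => ?_
    have : v ≠ P.output k := by rintro rfl; exact ho hv
    simp [Pattern.measure, Function.update_of_ne this]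

/-- Pauli operators on the outputs commute with the measurement of the other vertices. -/
theorem readout_pauli (P : Pattern V n κ) (s : V → Bool) (D E : Finset κ) (ψ : State V) :
    P.readout s (pauliX (D.map P.output) (pauliZ (E.map P.output) ψ)) =
      pauliX D (pauliZ E (P.readout s ψ)) := by
  funext y
  rw [pauliX_apply, pauliZ_apply]
  simp only [readout, Finset.mul_sum]
  -- The `X` operators amount to the substitution `z ↦ flip z` in the sum, which leaves the bits of
  -- measured vertices alone.
  have hinv : Function.Involutive (flip (D.map P.output)) := flip_flip _
  rw [← Equiv.sum_comp (hinv.toPerm)]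
  refine Finset.sum_congr rfl fun z _ => ?_
  rw [Function.Involutive.coe_toPerm, flip_map_comp]
  have hiff : flip D (z ∘ P.output) = y ↔ z ∘ P.output = flip D y := by
    constructor
    · rintro rfl; rw [flip_flip]
    · intro h; rw [h, flip_flip]
  by_cases hz : z ∘ P.output = flip D y
  · rw [if_pos (hiff.2 hz), if_pos hz, pauliX_apply, pauliZ_apply, flip_flip, signOn_map, hz]
    have : ∏ v ∈ P.measured, (P.meas v).bra (s v) (flip (D.map P.output) z v) =
        ∏ v ∈ P.measured, (P.meas v).bra (s v) (z v) := by
      refine Finset.prod_congr rfl fun v hv => ?_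
      have : v ∉ D.map P.output := by
        intro h
        obtain ⟨k, -, hk⟩ := Finset.mem_map.1 h
        exact (P.mem_measured v).1 hv k hk
      simp [flip, this]
    rw [this]
    ring
  · rw [if_neg fun h => hz (hiff.1 h), if_neg hz, mul_zero]

/-- The outcome 1 is repaired by `X_D Z_E` on the remaining outputs. These operators commute with
the earlier bras, and commuting them with the earlier corrections costs a global sign only. -/
theorem Realizes.measure {P : Pattern V n κ} {A : (Fin n → Bool) → State κ} (h : P.Realizes A)
    (f : κ' ↪ κ) {k : κ} (M : Measurement)
    (hf : ∀ l, l = k ∨ ∃ l', f l' = l) (hk : ∀ l', f l' ≠ k) (D E : Finset κ')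
    (hDE : ∃ c : ℂ, ‖c‖ = 1 ∧ ∀ x, pauliX D (pauliZ E (contract f k (M.bra true) (A x))) =
      c • contract f k (M.bra false) (A x)) :
    (P.measure f k M).Realizes (fun x => contract f k (M.bra false) (A x)) := by
  obtain ⟨time, corrX, corrZ, htime, hrun⟩ := h
  obtain ⟨d, hd, hDE⟩ := hDE
  have hmeas := measured_measure P f M hf hk
  set o := P.output k with ho
  have hoM : o ∉ P.measured := fun h => (P.mem_measured _).1 h k rfl
  set P' := P.measure f k M with hP'
  -- The new measurement comes after all others, so earlier corrections of `o`, made while it was an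
  -- output, remain legitimate.
  refine ⟨Function.update time o (Finset.univ.sup time + 1),
    Function.update corrX o (D.map P'.output), Function.update corrZ o (E.map P'.output), ?_, ?_⟩
  · intro u hu v hv hvm
    have hv' : v ∉ D.map P'.output ∪ E.map P'.output := by
      rw [Finset.mem_union, Finset.mem_map, Finset.mem_map]
      rintro (⟨l, -, hl⟩ | ⟨l, -, hl⟩) <;> exact (P'.mem_measured v).1 hvm l hl
    by_cases huo : u = o
    · subst huo
      rw [Function.update_self, Function.update_self] at hv
      exact absurd hv hv'
    · rw [Function.update_of_ne huo, Function.update_of_ne huo] at hv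
      rw [hmeas, Finset.mem_insert] at hu hvm
      rw [Function.update_of_ne huo]
      by_cases hvo : v = o
      · rw [hvo, Function.update_self]
        exact Nat.lt_succ_of_le (Finset.le_sup (f := time) (Finset.mem_univ u))
      · rw [Function.update_of_ne hvo]
        exact htime u (hu.resolve_left huo) v hv (hvm.resolve_left hvo)
  · intro s
    obtain ⟨c, hc, hrun⟩ := hrun s
    have hamp : ∀ x, P'.amp x = P.amp x := fun x => rfl
    simp only [run, hmeas, oddSet_insert_update _ _ _ _ hoM, hamp]
    simp only [run] at hrun
    set B := oddSet P.measured corrX s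
    set C := oddSet P.measured corrZ s
    have hcontract : ∀ (c : ℂ) (β : Bool → ℂ) (ψ : State κ),
        contract f k β (c • ψ) = c • contract f k β ψ := by
      intro c β ψ
      funext y
      simp only [contract, Pi.smul_apply, smul_eq_mul, Finset.mul_sum]
      refine Finset.sum_congr rfl fun z _ => ?_
      split_ifs <;> ring
    by_cases hs : s o = true
    -- The sign from moving `Z_E` past the accumulated `X_B`.
    · set ε : ℂ := signOn (E.map P'.output) (fun v => decide (v ∈ B)) with hε
      refine ⟨ε * c * d, by rw [norm_mul, norm_mul, hε, norm_signOn, hc, hd]; norm_num,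
        fun x => ?_⟩
      have hcomm : pauliX (symmDiff (D.map P'.output) B)
          (pauliZ (symmDiff (E.map P'.output) C) (P.amp x)) =
          ε • pauliX (D.map P'.output) (pauliZ (E.map P'.output)
            (pauliX B (pauliZ C (P.amp x)))) := by
        funext z
        rw [Pi.smul_apply, smul_eq_mul, pauliX_apply, pauliX_apply, pauliZ_apply, pauliZ_apply,
          pauliX_apply, pauliZ_apply, signOn_symmDiff, symmDiff_comm, flip_symmDiff,
          signOn_flip B (E.map P'.output)]
        ring
      rw [if_pos hs, if_pos hs, hcomm, readout_smul, readout_pauli, hP',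
        readout_measure P f M hf hk, hrun, ← ho, hs, hcontract]
      have h2 : ∀ ψ : State κ', pauliX D (pauliZ E (c • ψ)) = c • pauliX D (pauliZ E ψ) := by
        intro ψ
        funext y
        simp only [pauliX_apply, pauliZ_apply, Pi.smul_apply, smul_eq_mul]
        ring
      rw [h2, hDE, smul_smul, smul_smul]
    · refine ⟨c, hc, fun x => ?_⟩
      rw [if_neg hs, if_neg hs, hP', readout_measure P f M hf hk, hrun, hcontract, ← ho]
      rw [Bool.not_eq_true] at hs
      rw [hs]

end Pattern
end OneWay

namespace OneWay

/-! ### Measured open graphs as patterns, and their normalisation -/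

namespace MeasuredOpenGraph

variable {V : Type} [Fintype V] [DecidableEq V] {n : ℕ}

/-- A measured open graph, regarded as a pattern. -/
def toPattern (P : MeasuredOpenGraph V n) : Pattern V n (Fin n) :=
  ⟨P.graph, P.input, P.output, P.meas⟩

/-- Orthogonality of characters: the sum factors into `1 + (-1)^(x_i + w_i)` over the wires. The
entangling operation thus restricts the graph state to assignments which agree with the input. -/
theorem sum_sign_subsets (x w : Fin n → Bool) :
    ∑ S : Finset (Fin n), (∏ i ∈ S, bitSign (x i)) * signOn S w =
      if w = x then (2 : ℂ) ^ n else 0 := by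
  have h : ∑ S : Finset (Fin n), (∏ i ∈ S, bitSign (x i)) * signOn S w =
      ∏ i, (1 + bitSign (x i) * bitSign (w i)) := by
    rw [Finset.prod_one_add, Finset.powerset_univ]
    simp only [signOn, Finset.prod_mul_distrib]
  rw [h]
  split_ifs with hx
  · subst hx
    simp only [bitSign_mul_self]
    norm_num
  · obtain ⟨i, hi⟩ := Function.ne_iff.1 hx
    refine Finset.prod_eq_zero (Finset.mem_univ i) ?_
    revert hi
    cases w i <;> cases x i <;> simp [bitSign]

theorem entangle_eq (P : MeasuredOpenGraph V n) (x : Fin n → Bool) :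
    P.entangle x = ((2 : ℂ) ^ n / ((Real.sqrt (2 ^ n) : ℝ) * (Real.sqrt (2 ^ Fintype.card V) : ℝ))) •
      P.toPattern.amp x := by
  funext z
  have h : ∀ S : Finset (Fin n), (∏ i ∈ S, bitSign (x i)) *
      signedGraphState P.graph (S.map P.input) z =
      ((∏ i ∈ S, bitSign (x i)) * signOn S (z ∘ P.input)) * graphState P.graph z := by
    intro S
    rw [signedGraphState, pauliZ_apply, signOn_map, mul_assoc]
  rw [MeasuredOpenGraph.entangle]
  simp only [h]
  rw [← Finset.sum_mul, sum_sign_subsets, Pi.smul_apply, smul_eq_mul]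
  have hamp : P.toPattern.amp x z = if z ∘ P.input = x then edgeSign P.graph z else 0 := rfl
  rw [hamp, graphState, edgeSign]
  split_ifs
  · field_simp
  · simp

theorem simulates_of_realizes {P : MeasuredOpenGraph V n} {A : (Fin n → Bool) → State (Fin n)}
    (h : P.toPattern.Realizes A) : P.Simulates (fun y x => A x y) := by
  obtain ⟨time, corrX, corrZ, htime, hrun⟩ := h
  let C : CorrectionStrategy P := ⟨time, corrX, corrZ, htime⟩
  refine ⟨C, fun s => ?_⟩
  obtain ⟨c, hc, hrun⟩ := hrun s
  refine ⟨c, hc, ?_⟩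
  have hcard : P.measured.card + n = Fintype.card V := by
    have := Finset.card_compl_add_card (Finset.univ.map P.output)
    rw [Finset.card_map, Finset.card_univ, Fintype.card_fin] at this
    rw [← this]
    congr 2
    ext v
    simp [MeasuredOpenGraph.measured]
  set γ : ℂ := (2 : ℂ) ^ n / ((Real.sqrt (2 ^ n) : ℝ) * (Real.sqrt (2 ^ Fintype.card V) : ℝ))
    with hγ
  -- Since `|V| = k + n` with `k` measured vertices, `γ` is `2^(-k/2)`, exactly the factor which
  -- `Simulates` removes.
  have hγ1 : ((Real.sqrt (2 ^ P.measured.card) : ℝ) : ℂ) * γ = 1 := by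
    have h1 : ((Real.sqrt (2 ^ n) : ℝ) : ℂ) * ((Real.sqrt (2 ^ n) : ℝ) : ℂ) = 2 ^ n := by
      rw [← Complex.ofReal_mul, Real.mul_self_sqrt (by positivity)]; push_cast; rfl
    have h2 : ((Real.sqrt (2 ^ Fintype.card V) : ℝ) : ℂ) =
        ((Real.sqrt (2 ^ P.measured.card) : ℝ) : ℂ) * ((Real.sqrt (2 ^ n) : ℝ) : ℂ) := by
      rw [← hcard, pow_add, Real.sqrt_mul (by positivity), Complex.ofReal_mul]
    have h3 : ((Real.sqrt (2 ^ n) : ℝ) : ℂ) ≠ 0 := by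
      exact_mod_cast (Real.sqrt_pos.2 (by positivity)).ne'
    have h4 : ((Real.sqrt (2 ^ P.measured.card) : ℝ) : ℂ) ≠ 0 := by
      exact_mod_cast (Real.sqrt_pos.2 (by positivity)).ne'
    rw [hγ, h2, ← h1]
    field_simp
  ext y x
  have hx := congrFun (hrun x) y
  have hb : P.branch C s y x =
      γ * P.toPattern.run corrX corrZ s x y := by
    simp only [MeasuredOpenGraph.branch, Pattern.run, Pattern.readout, Finset.mul_sum]
    refine Finset.sum_congr rfl fun z _ => ?_
    rw [mul_ite, mul_zero]
    refine if_congr Iff.rfl ?_ rfl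
    rw [entangle_eq, ← hγ]
    simp only [pauliX, pauliZ, Pi.smul_apply, smul_eq_mul]
    have h1 : P.toPattern.measured = P.measured := rfl
    have h2 : P.toPattern.meas = P.meas := rfl
    have h3 : ∀ corr, P.corrected corr s = oddSet P.measured corr s := fun _ => rfl
    have h4 : C.corrX = corrX := rfl
    have h5 : C.corrZ = corrZ := rfl
    rw [h1, h2, h3, h3, h4, h5]
    ring
  change _ * P.branch C s y x = c * A x y
  rw [hb, hx, ← mul_assoc, hγ1, one_mul, Pi.smul_apply, smul_eq_mul]

end MeasuredOpenGraph

namespace Pattern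

variable {V κ κ' : Type} [Fintype V] [DecidableEq V] [Fintype κ] [DecidableEq κ]
  [Fintype κ'] [DecidableEq κ'] {n m : ℕ}

/-! ### Elementary patterns -/

/-- The pattern in which all vertices are inputs and outputs, without edges. -/
noncomputable def start (n : ℕ) : Pattern (Fin n) n (Fin n) :=
  ⟨⊥, Function.Embedding.refl _, Function.Embedding.refl _, fun _ => measX⟩

/-- The computational basis state `|x⟩`. -/
def basisState (x : κ → Bool) : State κ := fun y => if y = x then 1 else 0

theorem edgeSign_bot (z : V → Bool) : edgeSign (⊥ : SimpleGraph V) z = 1 := by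
  simp [edgeSign]

theorem realizes_start (n : ℕ) : (start n).Realizes basisState := by
  have hm : (start n).measured = ∅ := by
    ext v
    simp [start, mem_measured]
  refine ⟨0, fun _ => ∅, fun _ => ∅, by simp, fun s => ⟨1, by simp, fun x => ?_⟩⟩
  have h0 : oddSet (∅ : Finset (Fin n)) (fun _ => ∅) s = ∅ := by
    ext v; simp [oddSet]
  funext y
  simp only [run, readout, h0, hm, Finset.prod_empty, one_mul, one_smul, pauliX_apply,
    pauliZ_apply, flip_empty]
  have hout : ∀ z : Fin n → Bool, z ∘ (start n).output = z := fun z => rfl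
  have hin : ∀ z : Fin n → Bool, z ∘ (start n).input = z := fun z => rfl
  simp only [hout, amp, hin]
  simp [signOn, basisState, start, edgeSign_bot]

theorem XZ_start (n : ℕ) : (start n).XZ ∅ := by
  have hm : ∀ v, v ∉ (start n).measured := by
    intro v
    simp [start, mem_measured]
  exact ⟨fun v hv => absurd hv (hm v), fun i hi => absurd hi (hm _), by simp⟩

theorem XZ.mono {P : Pattern V n κ} {F F' : Set κ} (h : P.XZ F) (hF : F' ⊆ F) : P.XZ F' :=
  ⟨h.1, h.2.1, fun k hk => h.2.2 k (hF hk)⟩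

/-- The embedding which replaces the wire `t` by the fresh one. -/
def rewire (t : κ) : κ ↪ Option κ :=
  ⟨fun k => if k = t then none else some k, by
    intro k l h
    by_cases hk : k = t <;> by_cases hl : l = t <;> simp_all⟩

theorem rewire_self (t : κ) : rewire t t = none := if_pos rfl

theorem rewire_of_ne {t k : κ} (h : k ≠ t) : rewire t k = some k := if_neg h

theorem rewire_cover (t : κ) (l : Option κ) : l = some t ∨ ∃ l', rewire t l' = l := by
  rcases l with _ | l
  · exact Or.inr ⟨t, rewire_self t⟩
  · by_cases hl : l = t
    · exact Or.inl (by rw [hl])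
    · exact Or.inr ⟨l, rewire_of_ne hl⟩

theorem rewire_ne (t l : κ) : rewire t l ≠ some t := by
  by_cases hl : l = t <;> simp [rewire_self, rewire_of_ne, hl]

/-- The output `t` is linked to a fresh output and then measured. The fresh vertex carries the
measurement `M₀`, which is not performed. -/
def teleport (P : Pattern (Fin m) n κ) (t : κ) (M M₀ : Measurement) : Pattern (Fin (m + 1)) n κ :=
  ((P.prepare M₀).entangle (some t) none).measure (rewire t) (some t) M

/-- The operation performed by teleportation with the bra `β`. -/
noncomputable def teleportOp (t : κ) (β : Bool → ℂ) (ψ : State κ) : State κ :=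
  fun y => ∑ b, β b * (bitSign (b && y t) * ψ (Function.update y t b))

/-- The bra of outcome 1 differs from that of outcome 0 by a `Z`. The link transports this `Z` into
an `X` on the fresh vertex, which is the correction. -/
theorem Realizes.teleport {P : Pattern (Fin m) n κ} {A : (Fin n → Bool) → State κ}
    (h : P.Realizes A) (t : κ) {M : Measurement} (M₀ : Measurement)
    (hM : ∀ b, M.bra true b = bitSign b * M.bra false b) :
    (P.teleport t M M₀).Realizes (fun x => teleportOp t (M.bra false) (A x)) := by
  have hc : ∀ β x, contract (rewire t) (some t) β (cz (some t) none (fun y => A x (y ∘ some))) =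
      teleportOp t β (A x) := by
    intro β x
    funext y
    -- The fresh vertex takes over the output bit `y t`, while the measured one runs over `b`.
    rw [contract_apply (rewire_cover t) β _ y
      (fun b o => o.elim (y t) (Function.update y t b))]
    · refine Finset.sum_congr rfl fun b _ => ?_
      simp only [cz, Option.elim_some, Option.elim_none, Function.update_self]
      rfl
    · intro b
      funext k
      by_cases hk : k = t
      · subst hk; simp [rewire_self]
      · simp [rewire_of_ne, hk]
    · intro b; simp
  have := ((h.prepare M₀).entangle (a := some t) (b := none) (by simp)).measure (rewire t) M
    (rewire_cover t) (rewire_ne t) {t} ∅ ⟨1, by simp, fun x => ?_⟩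
  · simp only [hc] at this
    exact this
  · rw [hc, hc, one_smul]
    funext y
    rw [pauliX_apply, pauliZ_apply]
    simp only [signOn, Finset.prod_empty, one_mul, teleportOp, hM]
    refine Finset.sum_congr rfl fun b _ => ?_
    have h1 : Function.update (flip {t} y) t b = Function.update y t b := by
      funext k
      by_cases hk : k = t
      · subst hk; simp
      · simp [hk, flip]
    have h2 : bitSign b * bitSign (b && flip {t} y t) = bitSign (b && y t) := by
      cases b <;> cases h : y t <;> simp [bitSign, flip, h]
    rw [h1, ← h2]
    ring

theorem XZ.teleport {P : Pattern (Fin m) n κ} {F : Set κ} (h : P.XZ F) (t : κ)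
    (M₀ : Measurement) : (P.teleport t measX M₀).XZ F := by
  refine (((h.prepare M₀).entangle (some t) none).measure (rewire t) (rewire_cover t)
    (rewire_ne t) (M := measX) trivial (Or.inl rfl)).mono fun k hk => ?_
  by_cases hkt : k = t
  · simp [rewire_self, hkt]
  · simp [rewire_of_ne, hkt, hk]

theorem measX_bra_false (b : Bool) : measX.bra false b = 1 / ((Real.sqrt 2 : ℝ) : ℂ) := by
  have h : Real.pi / 2 / 2 = Real.pi / 4 := by ring
  have h2 : Real.sqrt 2 / 2 = 1 / Real.sqrt 2 := by
    rw [div_eq_div_iff (by norm_num) (by positivity), Real.mul_self_sqrt (by norm_num), one_mul]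
  cases b <;>
  · simp only [Measurement.bra, measX, Measurement.ket, h, Real.cos_pi_div_four,
      Real.sin_pi_div_four, h2, Complex.conj_ofReal]
    push_cast; rfl

theorem measX_bra_true (b : Bool) : measX.bra true b = bitSign b * measX.bra false b := by
  have h : Real.pi / 2 / 2 = Real.pi / 4 := by ring
  cases b <;>
  simp [Measurement.bra, measX, Measurement.ket, h, Real.cos_pi_div_four,
      Real.sin_pi_div_four, bitSign]

theorem xy_bra_true (α : ℝ) (b : Bool) :
    (Measurement.xy α).bra true b = bitSign b * (Measurement.xy α).bra false b := by
  cases b <;> simp [Measurement.bra, Measurement.ket, bitSign, neg_div]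

/-- The Hadamard gate on the wire `t`. -/
noncomputable def hadamard (t : κ) : State κ → State κ :=
  teleportOp t (fun _ => 1 / ((Real.sqrt 2 : ℝ) : ℂ))

theorem Realizes.teleport_measX {P : Pattern (Fin m) n κ} {A : (Fin n → Bool) → State κ}
    (h : P.Realizes A) (t : κ) (M₀ : Measurement) :
    (P.teleport t measX M₀).Realizes (fun x => hadamard t (A x)) := by
  have := h.teleport t M₀ measX_bra_true
  have hb : measX.bra false = fun _ => 1 / ((Real.sqrt 2 : ℝ) : ℂ) := funext measX_bra_false
  rw [hb] at this
  exact this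

theorem inv_sqrt_two_mul_self :
    (1 / ((Real.sqrt 2 : ℝ) : ℂ)) * (1 / ((Real.sqrt 2 : ℝ) : ℂ)) = 1 / 2 := by
  rw [div_mul_div_comm, ← Complex.ofReal_mul, Real.mul_self_sqrt (by norm_num)]
  norm_num

/-- The rotation `cos (θ/2) + sin (θ/2) X Z` of the wire `t`. -/
noncomputable def rotation (t : κ) (θ : ℝ) (ψ : State κ) : State κ :=
  (Real.cos (θ / 2) : ℂ) • ψ + (Real.sin (θ / 2) : ℂ) • pauliX {t} (pauliZ {t} ψ)

/-- The pattern which rotates the wire `t` by means of a fresh ancilla. -/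
noncomputable def rotate (P : Pattern (Fin m) n κ) (t : κ) (θ : ℝ) :
    Pattern (Fin (m + 1 + 1 + 1)) n κ :=
  (((((P.prepare measX).entangle (some t) none).teleport (some t) measX measX).entangle
    (some t) none).teleport (some t) measX measX).measure Function.Embedding.some none
      (Measurement.xz θ)

theorem flip_singleton (t : κ) (y : κ → Bool) : flip {t} y = Function.update y t (!y t) := by
  funext k
  by_cases hk : k = t
  · subst hk; simp [flip]
  · simp [flip, hk]

/-- When the ancilla carries 1, the two links perform `HZHZ = XZ` on the wire `t`; when it carries
0, they perform `HH = 1`. -/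
theorem ancilla_apply (t : κ) (ψ : State κ) (y : κ → Bool) (b : Bool) :
    hadamard (some t) (cz (some t) none (hadamard (some t) (cz (some t) none
      (fun w => ψ (w ∘ some))))) (fun o => o.elim b y) =
      if b then pauliX {t} (pauliZ {t} ψ) y else ψ y := by
  have hup : ∀ b₁ b₂ : Bool, Function.update (Function.update (fun o : Option κ => o.elim b y)
      (some t) b₁) (some t) b₂ ∘ some = Function.update y t b₂ := by
    intro b₁ b₂
    funext k
    by_cases hk : k = t
    · subst hk; simp
    · simp [hk]
  have hhalf := inv_sqrt_two_mul_self
  have hy : Function.update y t (y t) = y := Function.update_eq_self _ _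
  simp only [hadamard, teleportOp, cz, hup, Fintype.sum_bool, Function.update_self,
    Function.update_of_ne (show (none : Option κ) ≠ some t by simp), Option.elim_some, Option.elim_none,
    pauliX_apply, pauliZ_apply, flip_singleton, signOn, Finset.prod_singleton]
  generalize (1 / ((Real.sqrt 2 : ℝ) : ℂ)) = r at hhalf
  cases b <;> cases h : y t <;> rw [h] at hy <;> simp [bitSign, hy] <;>
    first
    | linear_combination (2 * ψ y) * hhalf
    | linear_combination (2 * ψ (Function.update y t false)) * hhalf
    | linear_combination (-(2 * ψ (Function.update y t true))) * hhalf

theorem flip_singleton_apply_self (t : κ) (y : κ → Bool) : flip {t} y t = !y t := by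
  simp [flip]

theorem pauliXZ_pauliXZ (t : κ) (ψ : State κ) :
    pauliX {t} (pauliZ {t} (pauliX {t} (pauliZ {t} ψ))) = -ψ := by
  funext y
  simp only [pauliX_apply, pauliZ_apply, flip_flip, signOn, Finset.prod_singleton,
    flip_singleton_apply_self, Pi.neg_apply]
  cases y t <;> simp [bitSign]

theorem xz_bra (θ : ℝ) : (Measurement.xz θ).bra false false = (Real.cos (θ / 2) : ℂ) ∧
    (Measurement.xz θ).bra false true = (Real.sin (θ / 2) : ℂ) ∧
    (Measurement.xz θ).bra true false = (Real.sin (θ / 2) : ℂ) ∧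
    (Measurement.xz θ).bra true true = -(Real.cos (θ / 2) : ℂ) := by
  simp only [Measurement.bra, Measurement.ket, map_neg, Complex.conj_ofReal, and_self]

theorem some_cover (l : Option κ) : l = none ∨ ∃ l', Function.Embedding.some l' = l := by
  rcases l with _ | l
  · exact Or.inl rfl
  · exact Or.inr ⟨l, rfl⟩

theorem some_ne_none (l : κ) : Function.Embedding.some l ≠ none := Option.some_ne_none l

theorem contract_some (β : Bool → ℂ) (ψ : State (Option κ)) (y : κ → Bool) :
    contract Function.Embedding.some none β ψ y = ∑ b, β b * ψ (fun o => o.elim b y) :=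
  contract_apply some_cover β ψ y _ (fun _ => rfl) fun _ => rfl

/-- The outcome 1 of the ancilla gives `sin (θ/2) - cos (θ/2) XZ`. Multiplying by `XZ` and using
`(XZ)² = -1` returns the operator of outcome 0, with no additional phase. -/
theorem Realizes.rotate {P : Pattern (Fin m) n κ} {A : (Fin n → Bool) → State κ}
    (h : P.Realizes A) (t : κ) (θ : ℝ) :
    (P.rotate t θ).Realizes (fun x => rotation t θ (A x)) := by
  have hc : ∀ β x, contract Function.Embedding.some none β
      (hadamard (some t) (cz (some t) none (hadamard (some t) (cz (some t) none
        (fun w => A x (w ∘ some)))))) = β false • A x + β true • pauliX {t} (pauliZ {t} (A x)) := by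
    intro β x
    funext y
    rw [contract_some]
    simp only [ancilla_apply, Fintype.sum_bool, Pi.add_apply, Pi.smul_apply, smul_eq_mul]
    simp [add_comm]
  obtain ⟨h00, h01, h10, h11⟩ := xz_bra θ
  have hne : some t ≠ none := by simp
  have := (((((h.prepare measX).entangle hne).teleport_measX (some t) measX).entangle
    hne).teleport_measX (some t) measX).measure Function.Embedding.some (k := none)
      (Measurement.xz θ) some_cover some_ne_none {t} {t} ⟨1, by simp, fun x => ?_⟩
  · simp only [hc, h00, h01] at this
    exact this
  · rw [hc, hc, h00, h01, h10, h11, one_smul]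
    have hlin : ∀ (c d : ℂ) (φ χ : State κ), pauliX {t} (pauliZ {t} (c • φ + d • χ)) =
        c • pauliX {t} (pauliZ {t} φ) + d • pauliX {t} (pauliZ {t} χ) := by
      intro c d φ χ
      funext y
      simp only [pauliX_apply, pauliZ_apply, Pi.add_apply, Pi.smul_apply, smul_eq_mul]
      ring
    rw [hlin, pauliXZ_pauliXZ, neg_smul_neg, add_comm]

theorem XZ.rotate {P : Pattern (Fin m) n κ} {F : Set κ} (h : P.XZ F) (t : κ) (θ : ℝ) :
    (P.rotate t θ).XZ F := by
  -- The ancilla is fresh and stays among the non-inputs through both links, so its angle is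
  -- unrestricted.
  refine ((((((h.prepare measX).entangle (some t) none).teleport (some t) measX).entangle
    (some t) none).teleport (some t) measX).measure Function.Embedding.some (k := none)
      (M := .xz θ) some_cover some_ne_none trivial (Or.inr (Or.inl rfl))).mono fun k hk => ?_
  simp [hk]

/-! ### Paths -/

theorem hadamard_hadamard (t : κ) (ψ : State κ) : hadamard t (hadamard t ψ) = ψ := by
  funext y
  have hhalf := inv_sqrt_two_mul_self
  have hy : Function.update y t (y t) = y := Function.update_eq_self _ _
  simp only [hadamard, teleportOp, Fintype.sum_bool, Function.update_self, Function.update_idem]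
  generalize (1 / ((Real.sqrt 2 : ℝ) : ℂ)) = r at hhalf
  cases h : y t <;> rw [h] at hy <;> simp [bitSign, hy] <;>
    linear_combination (2 * ψ y) * hhalf

theorem pathGraph_succ (m : ℕ) : toggleEdge ((SimpleGraph.pathGraph (m + 1)).map Fin.castSuccEmb)
    (Fin.castSucc (Fin.last m)) (Fin.last (m + 1)) = SimpleGraph.pathGraph (m + 2) := by
  ext u v
  have hmap : ∀ u v : Fin (m + 2),
      ((SimpleGraph.pathGraph (m + 1)).map Fin.castSuccEmb).Adj u v ↔
      (u.val + 1 = v.val ∨ v.val + 1 = u.val) ∧ u.val ≤ m ∧ v.val ≤ m := by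
    intro u v
    rw [SimpleGraph.map_adj]
    constructor
    · rintro ⟨a, b, h, rfl, rfl⟩
      rw [SimpleGraph.pathGraph_adj] at h
      have := a.isLt; have := b.isLt
      simp only [Fin.coe_castSuccEmb, Fin.val_castSucc]
      omega
    · rintro ⟨h, hu, hv⟩
      exact ⟨⟨u, by omega⟩, ⟨v, by omega⟩, SimpleGraph.pathGraph_adj.2 h, rfl, rfl⟩
  simp only [toggleEdge, hmap, SimpleGraph.pathGraph_adj, Sym2.eq_iff, Xor, Fin.ext_iff, ne_eq,
    Fin.val_castSucc, Fin.val_last]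
  have := u.isLt; have := v.isLt
  omega

/-- The path with `m` edges, from its input to its output. -/
def pathPattern (m : ℕ) (f : Fin (m + 1) → Measurement) : Pattern (Fin (m + 1)) 1 (Fin 1) where
  graph := SimpleGraph.pathGraph (m + 1)
  input := ⟨fun _ => 0, fun _ _ _ => Subsingleton.elim _ _⟩
  output := ⟨fun _ => Fin.last m, fun _ _ _ => Subsingleton.elim _ _⟩
  meas := f

/-- Teleporting the end of a path lengthens the path by one edge, so patterns on paths are iterated
teleportations. -/
theorem teleport_pathPattern (m : ℕ) (f : Fin (m + 1) → Measurement) (M M₀ : Measurement) :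
    (pathPattern m f).teleport 0 M M₀ = pathPattern (m + 1)
      (Function.update (Fin.snoc f M₀ : Fin (m + 2) → Measurement) (Fin.castSucc (Fin.last m))
        M) := by
  refine Pattern.ext (pathGraph_succ m) ?_ ?_ rfl
  · ext k; rfl
  · ext k; rw [Subsingleton.elim k 0]; rfl

theorem toPattern_pathX (m : ℕ) : (pathX m).toPattern = pathPattern m (fun _ => measX) := rfl

theorem teleport_pathX (m : ℕ) :
    (pathX m).toPattern.teleport 0 measX measX = (pathX (m + 1)).toPattern := by
  rw [toPattern_pathX, toPattern_pathX, teleport_pathPattern]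
  congr 1
  funext v
  refine Fin.lastCases ?_ (fun v => ?_) v <;> simp [Function.update_apply]

theorem start_one : start 1 = pathPattern 0 (fun _ => measX) := by
  refine Pattern.ext (Subsingleton.elim _ _) ?_ ?_ rfl <;>
  · ext k; rw [Subsingleton.elim k 0]; rfl

theorem realizes_pathX (m : ℕ) :
    (pathX m).toPattern.Realizes (fun x => (hadamard 0)^[m] (basisState x)) := by
  induction m with
  | zero => rw [toPattern_pathX, ← start_one]; exact realizes_start 1
  | succ m ih =>
    rw [← teleport_pathX]
    simp only [Function.iterate_succ_apply']
    exact ih.teleport_measX 0 measX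

theorem hadamard_iterate_odd {m : ℕ} (hm : Odd m) (t : κ) (ψ : State κ) :
    (hadamard t)^[m] ψ = hadamard t ψ := by
  obtain ⟨k, rfl⟩ := hm
  rw [Function.iterate_add_apply, Function.iterate_mul]
  have : (hadamard t)^[2] = id := funext fun ψ => hadamard_hadamard t ψ
  rw [this, Function.iterate_id]; rfl

theorem fin_one_fun (y : Fin 1 → Bool) : y = fun _ => y 0 := by
  funext i; rw [Subsingleton.elim i 0]

theorem hadamard_eq_gateH : (fun y x => hadamard (0 : Fin 1) (basisState x) y) = gateH := by
  funext y x
  rw [fin_one_fun y, fin_one_fun x]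
  generalize y 0 = a
  generalize x 0 = b
  have hup : ∀ c : Bool, (Function.update (fun _ : Fin 1 => a) 0 c) = fun _ => c := by
    intro c; funext i; rw [Subsingleton.elim i 0]; simp
  have hinj : ∀ c d : Bool, ((fun _ : Fin 1 => c) = fun _ => d) ↔ c = d :=
    fun c d => ⟨fun h => congrFun h 0, fun h => by rw [h]⟩
  simp only [hadamard, teleportOp, hup, basisState, hinj, gateH, gate1]
  cases a <;> cases b <;> simp [bitSign]

theorem simulates_pathX {m : ℕ} (hm : Odd m) : (pathX m).Simulates gateH := by
  have := MeasuredOpenGraph.simulates_of_realizes (realizes_pathX m)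
  simp only [hadamard_iterate_odd hm] at this
  rwa [hadamard_eq_gateH] at this

theorem simulates_edgeCZ : edgeCZ.Simulates gateCZ := by
  have hne : (0 : Fin 2) ≠ 1 := by decide
  have h : (start 2).entangle 0 1 = edgeCZ.toPattern := by
    have : toggleEdge (⊥ : SimpleGraph (Fin 2)) 0 1 = SimpleGraph.pathGraph 2 := by
      ext u v
      simp only [toggleEdge, SimpleGraph.bot_adj, SimpleGraph.pathGraph_adj, Xor]
      fin_cases u <;> fin_cases v <;> simp
    simp only [start, Pattern.entangle, MeasuredOpenGraph.toPattern, edgeCZ,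
      Function.Embedding.refl_apply, this]
  have := (realizes_start 2).entangle hne
  rw [h] at this
  have hU : gateCZ = fun y x => cz (0 : Fin 2) 1 (basisState x) y := by
    funext y x
    simp only [gateCZ, Matrix.diagonal_apply, cz, basisState]
    split_ifs with h <;> simp
  rw [hU]
  exact MeasuredOpenGraph.simulates_of_realizes this

end Pattern
end OneWay

namespace OneWay
namespace Pattern

variable {V κ κ' : Type} [Fintype V] [DecidableEq V] [Fintype κ] [DecidableEq κ]
  [Fintype κ'] [DecidableEq κ'] {n m : ℕ}

/-! ### The gadgets for `P(α)` -/

/-- A unimodular factor common to all inputs is absorbed in the phase of each branch. -/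
theorem Realizes.of_smul {P : Pattern V n κ} {A : (Fin n → Bool) → State κ} {c : ℂ}
    (hc : ‖c‖ = 1) (h : P.Realizes (fun x => c • A x)) : P.Realizes A := by
  obtain ⟨time, corrX, corrZ, htime, hrun⟩ := h
  refine ⟨time, corrX, corrZ, htime, fun s => ?_⟩
  obtain ⟨d, hd, hrun⟩ := hrun s
  exact ⟨d * c, by rw [norm_mul, hd, hc, one_mul], fun x => by rw [hrun, smul_smul]⟩

/-- The one-qubit state with amplitudes `p` and `q`. -/
def qubit (p q : ℂ) : State (Fin 1) := fun y => if y 0 then q else p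

theorem qubit_ext {p q p' q' : ℂ} (hp : p = p') (hq : q = q') : qubit p q = qubit p' q' := by
  rw [hp, hq]

theorem smul_qubit (c p q : ℂ) : c • qubit p q = qubit (c * p) (c * q) := by
  funext y
  simp only [qubit, Pi.smul_apply, smul_eq_mul]
  split_ifs <;> rfl

theorem add_qubit (p q p' q' : ℂ) : qubit p q + qubit p' q' = qubit (p + p') (q + q') := by
  funext y
  simp only [qubit, Pi.add_apply]
  split_ifs <;> rfl

theorem pauliXZ_qubit (p q : ℂ) : pauliX {0} (pauliZ {0} (qubit p q)) = qubit (-q) p := by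
  funext y
  simp only [pauliX_apply, pauliZ_apply, qubit, flip_singleton_apply_self, signOn,
    Finset.prod_singleton]
  cases y 0 <;> simp [bitSign]

theorem basisState_eq_qubit (x : Fin 1 → Bool) :
    basisState x = qubit (if x 0 then 0 else 1) (if x 0 then 1 else 0) := by
  funext y
  have : y = x ↔ y 0 = x 0 :=
    ⟨fun h => by rw [h], fun h => by rw [fin_one_fun y, fin_one_fun x, h]⟩
  simp only [basisState, this, qubit]
  cases y 0 <;> cases x 0 <;> simp

theorem teleportOp_qubit (β : Bool → ℂ) (p q : ℂ) : teleportOp 0 β (qubit p q) =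
    qubit (β false * p + β true * q) (β false * p - β true * q) := by
  funext y
  simp only [teleportOp, qubit, Fintype.sum_bool, Function.update_self]
  cases y 0 <;> simp [bitSign] <;> ring

theorem gateP_apply (α : ℝ) (y x : Fin 1 → Bool) : gateP α y x =
    qubit (if x 0 then Real.cos (α / 2) else Real.sin (α / 2))
      (if x 0 then -Real.sin (α / 2) else Real.cos (α / 2)) y := by
  simp only [gateP, gate1, qubit]
  cases x 0 <;> cases y 0 <;> simp

theorem toPattern_pathXY (α : ℝ) : (pathXY α).toPattern =
    ((((start 1).teleport 0 (.xy 0) measX).teleport 0 (.xy (Real.pi / 2)) measX).teleport 0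
      (.xy α) measX).teleport 0 (.xy (Real.pi / 2)) (.xy 0) := by
  rw [start_one, teleport_pathPattern, teleport_pathPattern, teleport_pathPattern,
    teleport_pathPattern]
  refine Pattern.ext rfl rfl rfl ?_
  funext v
  fin_cases v <;> rfl

theorem xy_bra_false (α : ℝ) (b : Bool) : (Measurement.xy α).bra false b =
    (if b then Complex.exp (-(Complex.I * α)) else 1) * (1 / ((Real.sqrt 2 : ℝ) : ℂ)) := by
  cases b
  · simp [Measurement.bra, Measurement.ket]
  · simp [Measurement.bra, Measurement.ket, bitSign, ← Complex.exp_conj, div_eq_mul_inv]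

theorem exp_mul_cos_half (α : ℝ) : Complex.exp (-(Complex.I * (α / 2))) * (Real.cos (α / 2) : ℂ) =
    (1 + Complex.exp (-(Complex.I * α))) / 2 := by
  have h1 : Complex.exp (-(Complex.I * α)) = Complex.exp (-(Complex.I * (α / 2))) *
      Complex.exp (-(Complex.I * (α / 2))) := by
    rw [← Complex.exp_add]; congr 1; ring
  have h2 : Complex.exp (Complex.I * (α / 2)) * Complex.exp (-(Complex.I * (α / 2))) = 1 := by
    rw [← Complex.exp_add, add_neg_cancel, Complex.exp_zero]
  push_cast
  rw [Complex.cos, h1, mul_comm (α / 2 : ℂ), neg_mul, mul_comm (α / 2 : ℂ)]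
  linear_combination h2 / 2

theorem exp_mul_sin_half (α : ℝ) : Complex.exp (-(Complex.I * (α / 2))) * (Real.sin (α / 2) : ℂ) =
    -Complex.I * (1 - Complex.exp (-(Complex.I * α))) / 2 := by
  have h1 : Complex.exp (-(Complex.I * α)) = Complex.exp (-(Complex.I * (α / 2))) *
      Complex.exp (-(Complex.I * (α / 2))) := by
    rw [← Complex.exp_add]; congr 1; ring
  have h2 : Complex.exp (Complex.I * (α / 2)) * Complex.exp (-(Complex.I * (α / 2))) = 1 := by
    rw [← Complex.exp_add, add_neg_cancel, Complex.exp_zero]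
  push_cast
  rw [Complex.sin, h1, mul_comm (α / 2 : ℂ), neg_mul, mul_comm (α / 2 : ℂ)]
  linear_combination (-Complex.I / 2) * h2

theorem simulates_pathXY (α : ℝ) : (pathXY α).Simulates (gateP α) := by
  have h := ((((realizes_start 1).teleport 0 measX (xy_bra_true 0)).teleport 0 measX
    (xy_bra_true (Real.pi / 2))).teleport 0 measX (xy_bra_true α)).teleport 0 (.xy 0)
      (xy_bra_true (Real.pi / 2))
  rw [← toPattern_pathXY] at h
  have hpi : Complex.exp (-(Complex.I * ((Real.pi / 2 : ℝ) : ℂ))) = -Complex.I := by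
    have : -(Complex.I * ((Real.pi / 2 : ℝ) : ℂ)) = -(Real.pi / 2 * Complex.I) := by
      push_cast; ring
    rw [this, Complex.exp_neg, Complex.exp_pi_div_two_mul_I, Complex.inv_I]
  have h0 : Complex.exp (-(Complex.I * ((0 : ℝ) : ℂ))) = 1 := by simp
  -- Each measurement contributes the bra `(1, e^{-iα}) / √2` at its own angle. With `w = e^{-iα}`
  -- the product is polynomial in `w` and `i`, and the half-angle formulas extract the phase
  -- `e^{-iα/2}`.
  have key : ∀ x : Fin 1 → Bool, teleportOp 0 ((Measurement.xy (Real.pi / 2)).bra false)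
      (teleportOp 0 ((Measurement.xy α).bra false)
        (teleportOp 0 ((Measurement.xy (Real.pi / 2)).bra false)
          (teleportOp 0 ((Measurement.xy 0).bra false) (basisState x)))) =
      Complex.exp (-(Complex.I * (α / 2))) • fun y => gateP α y x := by
    intro x
    have hg : (fun y => gateP α y x) = _ := funext fun y => gateP_apply α y x
    have hr := inv_sqrt_two_mul_self
    have hI := Complex.I_sq
    rw [hg, basisState_eq_qubit, teleportOp_qubit, teleportOp_qubit, teleportOp_qubit,
      teleportOp_qubit, smul_qubit]
    simp only [xy_bra_false, hpi, h0, if_true, Bool.false_eq_true, if_false, one_mul]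
    have hr4 : (1 / ((Real.sqrt 2 : ℝ) : ℂ)) ^ 4 = 1 / 4 := by
      linear_combination ((1 / ((Real.sqrt 2 : ℝ) : ℂ)) ^ 2 + 1 / 2) * hr
    generalize (1 / ((Real.sqrt 2 : ℝ) : ℂ)) = r at hr4
    have hc := exp_mul_cos_half α
    have hs := exp_mul_sin_half α
    generalize Complex.exp (-(Complex.I * α)) = w at hc hs
    cases x 0 <;> simp only [Bool.false_eq_true, if_true, if_false] <;> refine qubit_ext ?_ ?_
    · rw [hs]
      linear_combination ((1 - Complex.I) ^ 2 + w * (1 + Complex.I) ^ 2) * hr4 +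
        (1 / 4) * (1 + w) * hI
    · rw [hc]
      linear_combination ((1 - Complex.I ^ 2) * (1 + w)) * hr4 - (1 / 4) * (1 + w) * hI
    · rw [hc]
      linear_combination ((1 - Complex.I ^ 2) * (1 + w)) * hr4 - (1 / 4) * (1 + w) * hI
    · rw [mul_neg, hs]
      linear_combination ((1 + Complex.I) ^ 2 + w * (1 - Complex.I) ^ 2) * hr4 +
        (1 / 4) * (1 + w) * hI
  simp only [key] at h
  refine MeasuredOpenGraph.simulates_of_realizes (h.of_smul ?_)
  rw [Complex.norm_exp]
  simp

theorem map_castSuccEmb_adj {G : SimpleGraph (Fin m)} {R : ℕ → ℕ → Bool}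
    (h : ∀ u v : Fin m, G.Adj u v ↔ R u.val v.val = true) (u v : Fin (m + 1)) :
    (G.map Fin.castSuccEmb).Adj u v ↔
      (R u.val v.val && decide (u.val < m) && decide (v.val < m)) = true := by
  rw [SimpleGraph.map_adj]
  simp only [Bool.and_eq_true, decide_eq_true_eq]
  constructor
  · rintro ⟨a, b, hab, rfl, rfl⟩
    exact ⟨⟨(h a b).1 hab, a.isLt⟩, b.isLt⟩
  · rintro ⟨⟨hR, hu⟩, hv⟩
    exact ⟨⟨u, hu⟩, ⟨v, hv⟩, (h _ _).2 hR, rfl, rfl⟩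

theorem toggleEdge_adj {G : SimpleGraph (Fin m)} {R : ℕ → ℕ → Bool}
    (h : ∀ u v : Fin m, G.Adj u v ↔ R u.val v.val = true) (a b : Fin m) (u v : Fin m) :
    (toggleEdge G a b).Adj u v ↔ (decide (u.val ≠ v.val) && xor (R u.val v.val)
      (decide (u.val = a.val ∧ v.val = b.val ∨ u.val = b.val ∧ v.val = a.val))) = true := by
  simp only [toggleEdge, h, Sym2.eq_iff, Fin.ext_iff, ne_eq, Bool.and_eq_true, decide_eq_true_eq]
  refine and_congr_right fun _ => ?_
  by_cases h2 : u.val = a.val ∧ v.val = b.val ∨ u.val = b.val ∧ v.val = a.val <;>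
    simp [h2, Xor]

/-- With vertices numbered from 0, vertex 2 is the ancilla and the wire passes through 0, 1, 3, 4.
The edges of the wire, together with 12 and 23, form the path complemented at 2. -/
theorem toPattern_triangleXZ (α : ℝ) : (triangleXZ α).toPattern =
    ((start 1).teleport 0 measX measX).rotate 0 (Real.pi / 2 - α) := by
  rw [start_one, teleport_pathPattern]
  refine Pattern.ext ?_ ?_ ?_ ?_
  -- Adjacency is tracked by Boolean relations on the numbers of the vertices through each move, so
  -- that the comparison becomes a finite check.
  · let R : ℕ → ℕ → Bool := fun u v => decide (u + 1 = v ∨ v + 1 = u)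
    have h1 : ∀ u v : Fin 3, (toggleEdge ((SimpleGraph.pathGraph 2).map Fin.castSuccEmb)
        (Fin.castSucc (Fin.last 1)) (Fin.last 2)).Adj u v ↔ R u v = true := by
      intro u v
      rw [pathGraph_succ, SimpleGraph.pathGraph_adj, decide_eq_true_eq]
    let R₁ : ℕ → ℕ → Bool := fun u v => R u v && decide (u < 3) && decide (v < 3)
    let R₂ : ℕ → ℕ → Bool := fun u v => decide (u ≠ v) && xor (R₁ u v)
      (decide (u = 1 ∧ v = 3 ∨ u = 3 ∧ v = 1))
    let R₃ : ℕ → ℕ → Bool := fun u v => decide (u ≠ v) && xor (R₂ u v)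
      (decide (u = 3 ∧ v = 2 ∨ u = 2 ∧ v = 3))
    let R₄ : ℕ → ℕ → Bool := fun u v => R₃ u v && decide (u < 4) && decide (v < 4)
    have h2 := toggleEdge_adj (m := 4) (R := R₁) (map_castSuccEmb_adj (R := R) h1) 1 3
    have h3 := toggleEdge_adj (R := R₂) h2 3 2
    have h4 := toggleEdge_adj (m := 5) (R := R₄) (map_castSuccEmb_adj (R := R₃) h3) 3 4
    ext u v
    refine Iff.trans ?_ (h4 u v).symm
    change (localComplement (SimpleGraph.pathGraph 5) 2).Adj u v ↔ _
    simp only [localComplement, SimpleGraph.pathGraph_adj, Xor]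
    revert u v
    decide
  · ext k; rfl
  · ext k; rw [Subsingleton.elim k 0]; rfl
  · funext v
    fin_cases v <;> rfl

theorem simulates_triangleXZ (α : ℝ) : (triangleXZ α).Simulates (gateP α) := by
  have h := ((realizes_start 1).teleport_measX 0 measX).rotate 0 (Real.pi / 2 - α)
  rw [← toPattern_triangleXZ] at h
  have hr : (1 / ((Real.sqrt 2 : ℝ) : ℂ)) = ((Real.sqrt 2 / 2 : ℝ) : ℂ) := by
    rw [← Complex.ofReal_one, ← Complex.ofReal_div, ← Real.sqrt_div_self']
  have h2 : Real.sqrt 2 * Real.sqrt 2 = 2 := Real.mul_self_sqrt (by norm_num)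
  have hθ : (Real.pi / 2 - α) / 2 = Real.pi / 4 - α / 2 := by ring
  -- The Hadamard gate is a reflection, and rotating by `π/4 - α/2` after it gives the reflection
  -- `P(α)`.
  have key : ∀ x : Fin 1 → Bool, rotation 0 (Real.pi / 2 - α) (hadamard 0 (basisState x)) =
      fun y => gateP α y x := by
    intro x
    have hg : (fun y => gateP α y x) = _ := funext fun y => gateP_apply α y x
    rw [hg, basisState_eq_qubit, hadamard, teleportOp_qubit, rotation, pauliXZ_qubit, smul_qubit,
      smul_qubit, add_qubit, hθ, Real.cos_sub, Real.sin_sub, Real.cos_pi_div_four,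
      Real.sin_pi_div_four, hr]
    cases x 0 <;> simp only [Bool.false_eq_true, if_true, if_false] <;> refine qubit_ext ?_ ?_ <;>
      norm_cast
    · linear_combination (Real.sin (α / 2) / 2) * h2
    · linear_combination (Real.cos (α / 2) / 2) * h2
    · linear_combination (Real.cos (α / 2) / 2) * h2
    · linear_combination (-Real.sin (α / 2) / 2) * h2
  simp only [key] at h
  exact MeasuredOpenGraph.simulates_of_realizes h

end Pattern
end OneWay

namespace OneWay
namespace Pattern

variable {κ ι : Type} [Fintype κ] [DecidableEq κ] [Fintype ι] [DecidableEq ι]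

/-! ### Realizable operations -/

/-- The operation `T` can be appended to any pattern, with further measurements in the `(X,Z)`
plane. -/
def IsRealizable (T : State κ → State κ) : Prop :=
  ∀ (n m : ℕ) (F : Set κ) (P : Pattern (Fin m) n κ) (A : (Fin n → Bool) → State κ),
    P.XZ F → P.Realizes A → ∃ (m' : ℕ) (P' : Pattern (Fin m') n κ),
      P'.XZ F ∧ P'.Realizes (fun x => T (A x))

theorem isRealizable_id : IsRealizable (fun ψ : State κ => ψ) :=
  fun _ m _ P _ hF hA => ⟨m, P, hF, hA⟩

theorem IsRealizable.comp {S T : State κ → State κ} (hS : IsRealizable S) (hT : IsRealizable T) :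
    IsRealizable (fun ψ => S (T ψ)) := by
  intro n m F P A hF hA
  obtain ⟨m', P', hF', hA'⟩ := hT n m F P A hF hA
  exact hS n m' F P' _ hF' hA'

theorem isRealizable_cz {a b : κ} (hab : a ≠ b) : IsRealizable (cz a b) :=
  fun _ m _ P _ hF hA => ⟨m, P.entangle a b, hF.entangle a b, hA.entangle hab⟩

theorem isRealizable_rotation (t : κ) (θ : ℝ) : IsRealizable (rotation t θ) :=
  fun _ _ _ P _ hF hA => ⟨_, P.rotate t θ, hF.rotate t θ, hA.rotate t θ⟩

/-- The rotation of the wire `t` by an angle which depends on the other wires. -/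
noncomputable def mux (t : κ) (θ : (κ → Bool) → ℝ) (ψ : State κ) : State κ := fun y =>
  Real.cos (θ y) * ψ y - bitSign (y t) * Real.sin (θ y) * ψ (flip {t} y)

theorem bitSign_not (b : Bool) : bitSign (!b) = -bitSign b := by cases b <;> simp [bitSign]

theorem isRealizable_mux_const (t : κ) (c : ℝ) : IsRealizable (mux t (fun _ => c)) := by
  have : mux t (fun _ => c) = rotation t (2 * c) := by
    funext ψ y
    simp only [mux, rotation, Pi.add_apply, Pi.smul_apply, smul_eq_mul, pauliX_apply,
      pauliZ_apply, signOn, Finset.prod_singleton, flip_singleton_apply_self, bitSign_not,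
      mul_div_cancel_left₀ c (two_ne_zero' ℝ)]
    ring
  rw [this]
  exact isRealizable_rotation t _

/-- Since `φ` ignores the bit `t`, both operations are rotations in the same planes, and their
angles add. -/
theorem IsRealizable.mux_add {t : κ} {θ φ : (κ → Bool) → ℝ} (hφ : ∀ y, φ (flip {t} y) = φ y)
    (h₁ : IsRealizable (mux t θ)) (h₂ : IsRealizable (mux t φ)) :
    IsRealizable (mux t (fun y => θ y + φ y)) := by
  have : mux t (fun y => θ y + φ y) = fun ψ => mux t θ (mux t φ ψ) := by
    funext ψ y
    have hs := bitSign_mul_self (y t)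
    simp only [mux, hφ, flip_flip, flip_singleton_apply_self, bitSign_not, Real.cos_add,
      Real.sin_add]
    push_cast
    linear_combination (Complex.sin (θ y) * Complex.sin (φ y) * ψ y) * hs
  rw [this]
  exact h₁.comp h₂

/-- The real number `(-1)^b`. -/
def realSign (b : Bool) : ℝ := if b then -1 else 1

/-- Conjugation by `Z_t` negates `X_t Z_t`, hence the angle; the controlled `Z` performs it exactly
when the bit `u` is 1. -/
theorem IsRealizable.mux_sign {t u : κ} (htu : t ≠ u) {θ : (κ → Bool) → ℝ}
    (h : IsRealizable (mux t θ)) : IsRealizable (mux t (fun y => realSign (y u) * θ y)) := by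
  have : mux t (fun y => realSign (y u) * θ y) = fun ψ => cz t u (mux t θ (cz t u ψ)) := by
    funext ψ y
    have hu : flip {t} y u = y u := by simp [flip, htu.symm]
    simp only [mux, cz, hu, flip_singleton_apply_self]
    cases y t <;> cases y u <;> simp [bitSign, realSign]
    ring
  rw [this]
  exact (isRealizable_cz htu).comp (h.comp (isRealizable_cz htu))

/-- Fourier expansion in one bit at a time: if `θ₀`, `θ₁` are the restrictions to `u = 0, 1`, then
`θ = (θ₀ + θ₁)/2 + (-1)^u (θ₀ - θ₁)/2`, where both halves no longer depend on `u`. -/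
theorem isRealizable_mux_of_dependsOn {t : κ} (T : Finset κ) : t ∉ T → ∀ θ : (κ → Bool) → ℝ,
    (∀ y y', (∀ u ∈ T, y u = y' u) → θ y = θ y') → IsRealizable (mux t θ) := by
  induction T using Finset.induction_on with
  | empty =>
    intro _ θ hθ
    have : θ = fun _ => θ (fun _ => false) := funext fun y => hθ _ _ (by simp)
    rw [this]
    exact isRealizable_mux_const t _
  | insert u T hu ih =>
    intro ht θ hθ
    rw [Finset.mem_insert, not_or] at ht
    have hdep : ∀ b y y', (∀ v ∈ T, y v = y' v) →
        θ (Function.update y u b) = θ (Function.update y' u b) := by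
      intro b y y' h
      refine hθ _ _ fun v hv => ?_
      by_cases hvu : v = u
      · subst hvu; simp
      · simpa [hvu] using h v (Finset.mem_of_mem_insert_of_ne hv hvu)
    have h1 := ih ht.2 (fun y => (θ (Function.update y u false) + θ (Function.update y u true)) / 2)
      fun y y' h => by simp only [hdep _ y y' h]
    have h2 := ih ht.2 (fun y => (θ (Function.update y u false) - θ (Function.update y u true)) / 2)
      fun y y' h => by simp only [hdep _ y y' h]
    have hflip : ∀ y, θ (flip {t} y) = θ y := by
      intro y
      refine hθ _ _ fun v hv => ?_
      have : v ≠ t := by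
        rintro rfl
        rw [Finset.mem_insert] at hv
        tauto
      simp [flip, this]
    have h3 := h1.mux_add (φ := fun y => realSign (y u) *
      ((θ (Function.update y u false) - θ (Function.update y u true)) / 2)) (fun y => ?_)
      (h2.mux_sign ht.1)
    · convert h3 using 2
      funext y
      have hy : Function.update y u (y u) = y := Function.update_eq_self _ _
      cases h : y u <;> rw [h] at hy <;> simp [realSign, hy] <;> ring
    · have hu' : flip {t} y u = y u := by simp [flip, Ne.symm ht.1]
      have : ∀ b, θ (Function.update (flip {t} y) u b) = θ (Function.update y u b) := by
        intro b
        refine hdep b _ _ fun v hv => ?_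
        have : v ≠ t := by rintro rfl; exact ht.2 hv
        simp [flip, this]
      simp only [hu', this]

theorem isRealizable_mux {t : κ} {θ : (κ → Bool) → ℝ} (hθ : ∀ y, θ (flip {t} y) = θ y) :
    IsRealizable (mux t θ) := by
  refine isRealizable_mux_of_dependsOn (Finset.univ.erase t) (by simp) θ fun y y' h => ?_
  by_cases ht : y t = y' t
  · congr 1
    funext u
    by_cases hu : u = t
    · rw [hu, ht]
    · exact h u (by simp [hu])
  · rw [← hθ y']
    congr 1
    funext u
    by_cases hu : u = t
    · subst hu
      rw [flip_singleton_apply_self]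
      revert ht
      cases y u <;> cases y' u <;> simp
    · rw [h u (by simp [hu])]
      simp [flip, hu]

/-! ### Real matrices, with an idle ancilla -/

/-- The real matrix `M` acts on the wires `some i`. -/
noncomputable def lift (M : Matrix (ι → Bool) (ι → Bool) ℝ) (ψ : State (Option ι)) :
    State (Option ι) :=
  fun y => ∑ x, (M (y ∘ some) x : ℂ) * ψ (fun o => o.elim (y none) x)

theorem lift_mul (M N : Matrix (ι → Bool) (ι → Bool) ℝ) :
    lift (M * N) = fun ψ => lift M (lift N ψ) := by
  funext ψ y
  simp only [lift, Matrix.mul_apply, Finset.mul_sum, Complex.ofReal_sum, Finset.sum_mul]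
  rw [Finset.sum_comm]
  refine Finset.sum_congr rfl fun x _ => Finset.sum_congr rfl fun w _ => ?_
  push_cast
  rw [mul_assoc]
  rfl

theorem elim_none_comp_some (y : Option ι → Bool) :
    (fun o : Option ι => o.elim (y none) (y ∘ some)) = y := by
  funext o; cases o <;> rfl

theorem lift_one : lift (1 : Matrix (ι → Bool) (ι → Bool) ℝ) = fun ψ => ψ := by
  funext ψ y
  rw [lift, Finset.sum_eq_single (y ∘ some)]
  · rw [Matrix.one_apply_eq, elim_none_comp_some]; simp
  · intro x _ hx
    rw [Matrix.one_apply_ne (Ne.symm hx)]; simp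
  · simp

/-- The matrix of a rotation of the bit `t` by an angle which depends on the other bits. -/
noncomputable def muxMatrix (t : ι) (θ : (ι → Bool) → ℝ) : Matrix (ι → Bool) (ι → Bool) ℝ :=
  fun y x => Real.cos (θ y) * (if x = y then 1 else 0) -
    realSign (y t) * Real.sin (θ y) * (if x = flip {t} y then 1 else 0)

theorem muxMatrix_mulVec (t : ι) (θ : (ι → Bool) → ℝ) (v : (ι → Bool) → ℝ) (y : ι → Bool) :
    (muxMatrix t θ).mulVec v y =
      Real.cos (θ y) * v y - realSign (y t) * Real.sin (θ y) * v (flip {t} y) := by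
  simp only [Matrix.mulVec, dotProduct, muxMatrix, sub_mul, Finset.sum_sub_distrib, mul_assoc,
    ← Finset.mul_sum, ite_mul, one_mul, zero_mul, Finset.sum_ite_eq', Finset.mem_univ, if_true]

theorem ofReal_realSign (b : Bool) : (realSign b : ℂ) = bitSign b := by
  cases b <;> simp [realSign, bitSign]

theorem realSign_not (b : Bool) : realSign (!b) = -realSign b := by
  cases b <;> simp [realSign]

theorem realSign_mul_self (b : Bool) : realSign b * realSign b = 1 := by
  cases b <;> simp [realSign]

theorem lift_muxMatrix (t : ι) (θ : (ι → Bool) → ℝ) :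
    lift (muxMatrix t θ) = mux (some t) (fun y => θ (y ∘ some)) := by
  funext ψ y
  have hflip : (fun o : Option ι => o.elim (y none) (flip {t} (y ∘ some))) = flip {some t} y := by
    funext o
    cases o <;> simp [flip]
  simp only [lift, muxMatrix, mux]
  push_cast
  simp only [sub_mul, Finset.sum_sub_distrib, mul_assoc, ← Finset.mul_sum, ite_mul, one_mul,
    zero_mul, Finset.sum_ite_eq', Finset.mem_univ, if_true, elim_none_comp_some, hflip,
    ofReal_realSign, Function.comp_apply, apply_ite Complex.ofReal, Complex.ofReal_one,
    Complex.ofReal_zero]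

theorem isRealizable_muxMatrix {t : ι} {θ : (ι → Bool) → ℝ} (hθ : ∀ y, θ (flip {t} y) = θ y) :
    IsRealizable (lift (muxMatrix t θ)) := by
  rw [lift_muxMatrix]
  refine isRealizable_mux fun y => ?_
  have := flip_map_comp Function.Embedding.some {t} y
  rw [Finset.map_singleton] at this
  exact (congrArg θ this).trans (hθ _)

theorem transpose_muxMatrix {t : ι} {θ : (ι → Bool) → ℝ} (hθ : ∀ y, θ (flip {t} y) = θ y) :
    (muxMatrix t θ).transpose = muxMatrix t (fun y => -θ y) := by
  ext y x
  simp only [Matrix.transpose_apply, muxMatrix, Real.cos_neg, Real.sin_neg]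
  by_cases h1 : x = y
  · subst h1
    have : x ≠ flip {t} x := by
      intro h
      have := congrFun h t
      rw [flip_singleton_apply_self] at this
      cases h : x t <;> simp [h] at this
    simp [this]
  · by_cases h2 : x = flip {t} y
    · subst h2
      simp only [flip_flip, hθ, flip_singleton_apply_self, realSign_not, if_true, h1, Ne.symm h1,
        if_false]
      ring
    · have h3 : y ≠ flip {t} x := by
        rintro rfl; exact h2 (flip_flip _ _).symm
      simp [h1, h2, h3, Ne.symm h1]

theorem muxMatrix_mul_transpose {t : ι} {θ : (ι → Bool) → ℝ} (hθ : ∀ y, θ (flip {t} y) = θ y) :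
    muxMatrix t θ * (muxMatrix t θ).transpose = 1 := by
  rw [transpose_muxMatrix hθ]
  refine Matrix.ext_iff_mulVec.2 fun v => ?_
  funext y
  rw [← Matrix.mulVec_mulVec, Matrix.one_mulVec]
  simp only [muxMatrix_mulVec, Real.cos_neg, Real.sin_neg, hθ, flip_flip,
    flip_singleton_apply_self, realSign_not]
  have h1 := realSign_mul_self (y t)
  have h2 := Real.sin_sq_add_cos_sq (θ y)
  linear_combination (Real.sin (θ y) ^ 2 * v y) * h1 + v y * h2

/-! ### Clearing a real vector, and realizing reflections -/

theorem exists_angle (a b : ℝ) : ∃ φ : ℝ, Real.cos φ * a + Real.sin φ * b = 0 := by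
  by_cases h : (⟨b, -a⟩ : ℂ) = 0
  · have ha := congrArg Complex.im h
    have hb := congrArg Complex.re h
    simp at ha hb
    exact ⟨0, by simp [ha]⟩
  · refine ⟨Complex.arg ⟨b, -a⟩, ?_⟩
    have h1 := Complex.norm_mul_cos_arg ⟨b, -a⟩
    have h2 := Complex.norm_mul_sin_arg ⟨b, -a⟩
    simp only at h1 h2
    have h3 : ‖(⟨b, -a⟩ : ℂ)‖ ≠ 0 := norm_ne_zero_iff.2 h
    refine (mul_eq_zero.1 (?_ : ‖(⟨b, -a⟩ : ℂ)‖ * _ = 0)).resolve_left h3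
    linear_combination a * h1 + b * h2

/-- Multiplexed rotations bring any vector to the line of the basis vector `0`. -/
theorem exists_realizable_clear (T : Finset ι) (v : (ι → Bool) → ℝ) :
    ∃ W : Matrix (ι → Bool) (ι → Bool) ℝ, IsRealizable (lift W) ∧
      IsRealizable (lift W.transpose) ∧ W * W.transpose = 1 ∧
      ∀ y, (∃ t ∈ T, y t = true) → W.mulVec v y = 0 := by
  induction T using Finset.induction_on with
  | empty => exact ⟨1, by rw [lift_one]; exact isRealizable_id,
      by rw [Matrix.transpose_one, lift_one]; exact isRealizable_id, by simp, by simp⟩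
  | insert t T ht ih =>
    obtain ⟨W, h1, h2, h3, h4⟩ := ih
    set w := W.mulVec v with hw
    choose φ hφ using fun y : ι → Bool =>
      exists_angle (w (Function.update y t true)) (w (Function.update y t false))
    -- Resetting the bit `t` makes the angle independent of it. In each pair of entries differing in
    -- `t`, the rotation kills the one with bit 1.
    set θ : (ι → Bool) → ℝ := fun y => φ (Function.update y t false) with hθ
    have hθf : ∀ y, θ (flip {t} y) = θ y := by
      intro y
      simp only [hθ, flip_singleton, Function.update_idem]
    have hθf' : ∀ y, -θ (flip {t} y) = -θ y := fun y => by rw [hθf]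
    refine ⟨muxMatrix t θ * W, ?_, ?_, ?_, ?_⟩
    · rw [lift_mul]
      exact (isRealizable_muxMatrix hθf).comp h1
    · rw [Matrix.transpose_mul, lift_mul, transpose_muxMatrix hθf]
      exact h2.comp (isRealizable_muxMatrix hθf')
    · rw [Matrix.transpose_mul, Matrix.mul_assoc, ← Matrix.mul_assoc W, h3, Matrix.one_mul,
        muxMatrix_mul_transpose hθf]
    · rintro y ⟨u, hu, hyu⟩
      rw [← Matrix.mulVec_mulVec, ← hw, muxMatrix_mulVec]
      by_cases hyt : y t = true
      · have hy := hφ (Function.update y t false)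
        rw [Function.update_idem, Function.update_idem] at hy
        have e1 : Function.update y t true = y := by rw [← hyt]; exact Function.update_eq_self _ _
        have e2 : flip {t} y = Function.update y t false := by rw [flip_singleton, hyt]; rfl
        rw [e1] at hy
        rw [e2, hyt]
        simp only [realSign, if_true, hθ]
        linarith
      -- Entries cleared earlier stay zero: the rotation mixes two entries with the same bit `u`,
      -- and both vanish already.
      · have hut : u ≠ t := by rintro rfl; exact hyt hyu
        have huT : u ∈ T := Finset.mem_of_mem_insert_of_ne hu hut
        rw [h4 y ⟨u, huT, hyu⟩, h4 (flip {t} y) ⟨u, huT, by simp [flip, hut, hyu]⟩]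
        ring

/-- The reflection in the hyperplane orthogonal to `d`. -/
noncomputable def householder {X : Type} [Fintype X] [DecidableEq X] (d : X → ℝ) : Matrix X X ℝ :=
  1 - (2 / (d ⬝ᵥ d)) • Matrix.vecMulVec d d

theorem householder_mulVec {X : Type} [Fintype X] [DecidableEq X] (d v : X → ℝ) :
    (householder d).mulVec v = v - (2 / (d ⬝ᵥ d) * (d ⬝ᵥ v)) • d := by
  rw [householder, Matrix.sub_mulVec, Matrix.one_mulVec, Matrix.smul_mulVec,
    Matrix.vecMulVec_mulVec, op_smul_eq_smul, smul_smul]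

/-- Multiplexed rotations of the given wires have determinant 1, so they cannot produce a reflection
by themselves. They do carry `d` to an axis, and the idle ancilla supplies the remaining sign. -/
theorem isRealizable_householder {d : (ι → Bool) → ℝ} (hd : d ⬝ᵥ d ≠ 0) :
    IsRealizable (lift (householder d)) := by
  obtain ⟨W, h1, h2, h3, h4⟩ := exists_realizable_clear Finset.univ d
  have h3' : W.transpose * W = 1 := mul_eq_one_comm.1 h3
  set w := W.mulVec d with hw
  have hWw : W.transpose.mulVec w = d := by
    rw [hw, Matrix.mulVec_mulVec, h3', Matrix.one_mulVec]
  have hww : w ⬝ᵥ w = d ⬝ᵥ d := by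
    rw [hw, Matrix.dotProduct_mulVec, ← Matrix.mulVec_transpose, ← hw, hWw]
  have hconj : householder d = W.transpose * householder w * W := by
    refine Matrix.ext_iff_mulVec.2 fun v => ?_
    rw [← Matrix.mulVec_mulVec, ← Matrix.mulVec_mulVec, householder_mulVec, householder_mulVec,
      Matrix.mulVec_sub, Matrix.mulVec_smul, hWw, Matrix.mulVec_mulVec, h3', Matrix.one_mulVec,
      hww, Matrix.dotProduct_mulVec, ← Matrix.mulVec_transpose, hWw]
  have hsupp : ∀ y, y ≠ (fun _ => false) → w y = 0 := by
    intro y hy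
    obtain ⟨t, ht⟩ := Function.ne_iff.1 hy
    exact h4 y ⟨t, Finset.mem_univ t, by simpa using ht⟩
  have hw0 : w ⬝ᵥ w = w (fun _ => false) * w (fun _ => false) := by
    rw [dotProduct, Finset.sum_eq_single (fun _ => false)]
    · intro y _ hy
      rw [hsupp y hy, mul_zero]
    · simp
  -- A rotation by `π` is `-1` whatever the state of the ancilla; it is triggered when all other
  -- bits are 0.
  have hD : lift (householder w) =
      mux none (fun y => if y ∘ some = fun _ => false then Real.pi else 0) := by
    have hentry : ∀ y x, householder w y x =
        if x = y then (if y = (fun _ => false) then -1 else 1) else 0 := by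
      intro y x
      rw [householder, Matrix.sub_apply, Matrix.smul_apply, Matrix.vecMulVec_apply, smul_eq_mul]
      by_cases hy : y = fun _ => false
      · by_cases hx : x = y
        · subst hx
          subst hy
          rw [Matrix.one_apply_eq, hw0, if_pos rfl, if_pos rfl]
          rw [← hww, hw0] at hd
          rw [div_mul_cancel₀ _ hd]
          norm_num
        · rw [hsupp x (by rw [← hy]; exact hx), Matrix.one_apply_ne (Ne.symm hx), if_neg hx]
          ring
      · rw [hsupp y hy, if_neg hy, Matrix.one_apply]
        simp [eq_comm]
    funext ψ y
    simp only [lift, hentry, mux]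
    rw [Finset.sum_eq_single (y ∘ some)]
    · rw [if_pos rfl, elim_none_comp_some]
      split_ifs <;> simp
    · intro x _ hx
      rw [if_neg hx]; simp
    · simp
  rw [hconj, lift_mul, lift_mul, hD]
  refine (h2.comp (isRealizable_mux fun y => ?_)).comp h1
  have : flip {none} y ∘ some = y ∘ some := by
    funext i; simp [flip]
  rw [this]

end Pattern
end OneWay

namespace OneWay
namespace Pattern

variable {κ ι : Type} [Fintype κ] [DecidableEq κ] [Fintype ι] [DecidableEq ι]

/-! ### Universality -/

/-! ### Reflections generate the orthogonal group -/

section Householder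

variable {X : Type} [Fintype X] [DecidableEq X]

theorem householder_mulVec_householder {d : X → ℝ} (hd : d ⬝ᵥ d ≠ 0) (v : X → ℝ) :
    (householder d).mulVec ((householder d).mulVec v) = v := by
  simp only [householder_mulVec, dotProduct_sub, dotProduct_smul, smul_eq_mul]
  funext x
  simp only [Pi.sub_apply, Pi.smul_apply, smul_eq_mul]
  field_simp
  ring

theorem householder_mul_self {d : X → ℝ} (hd : d ⬝ᵥ d ≠ 0) : householder d * householder d = 1 :=
  Matrix.ext_iff_mulVec.2 fun v => by
    rw [← Matrix.mulVec_mulVec, householder_mulVec_householder hd, Matrix.one_mulVec]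

theorem transpose_householder (d : X → ℝ) : (householder d).transpose = householder d := by
  rw [householder, Matrix.transpose_sub, Matrix.transpose_one, Matrix.transpose_smul,
    Matrix.transpose_vecMulVec]

theorem householder_sub_mulVec {a b : X → ℝ} (hab : a ⬝ᵥ a = b ⬝ᵥ b)
    (hd : (a - b) ⬝ᵥ (a - b) ≠ 0) : (householder (a - b)).mulVec a = b := by
  have h : (a - b) ⬝ᵥ (a - b) = 2 * ((a - b) ⬝ᵥ a) := by
    simp only [sub_dotProduct, dotProduct_sub, ← hab, dotProduct_comm b a]
    ring
  have h2 : 2 / ((a - b) ⬝ᵥ (a - b)) * ((a - b) ⬝ᵥ a) = 1 := by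
    rw [div_mul_eq_mul_div, ← h, div_self hd]
  rw [householder_mulVec, h2, one_smul, sub_sub_cancel]

/-- A property of real matrices which holds for `1` and for all reflections, and which is
multiplicative, holds for all orthogonal matrices. -/
theorem orthogonal_induction {p : Matrix X X ℝ → Prop} (one : p 1)
    (mul : ∀ M N, p M → p N → p (M * N)) (refl : ∀ d : X → ℝ, d ⬝ᵥ d ≠ 0 → p (householder d))
    {U : Matrix X X ℝ} (hU : U.transpose * U = 1) : p U := by
  -- Induction on a set outside of which `U` fixes all basis vectors.
  suffices h : ∀ (T : Finset X) (U : Matrix X X ℝ), U.transpose * U = 1 →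
      (∀ x ∉ T, U.mulVec (Pi.single x 1) = Pi.single x 1) → p U from
    h Finset.univ U hU (by simp)
  intro T
  induction T using Finset.induction_on with
  | empty =>
    intro U _ h
    have : U = 1 := Matrix.ext_of_mulVec_single fun x => by
      rw [h x (by simp), Matrix.one_mulVec]
    rw [this]
    exact one
  | insert x T hx ih =>
    intro U hU h
    have hiso : ∀ a b : X → ℝ, U.mulVec a ⬝ᵥ U.mulVec b = a ⬝ᵥ b := by
      intro a b
      rw [Matrix.dotProduct_mulVec, ← Matrix.mulVec_transpose, Matrix.mulVec_mulVec, hU,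
        Matrix.one_mulVec]
    by_cases hfix : U.mulVec (Pi.single x 1) = Pi.single x 1
    · refine ih U hU fun y hy => ?_
      by_cases hyx : y = x
      · rw [hyx, hfix]
      · exact h y (by simp [hy, hyx])
    -- The vectors `a = U e_x` and `b = e_x` have equal length, so reflecting along `a - b` sends
    -- `a` back to `b`.
    · set a := U.mulVec (Pi.single x 1) with ha
      set b : X → ℝ := Pi.single x 1 with hb
      have hd : (a - b) ⬝ᵥ (a - b) ≠ 0 := fun h0 =>
        hfix (sub_eq_zero.1 (dotProduct_self_eq_zero.1 h0))
      have hS := householder_mul_self hd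
      have hU' : U = householder (a - b) * (householder (a - b) * U) := by
        rw [← Matrix.mul_assoc, hS, Matrix.one_mul]
      rw [hU']
      refine mul _ _ (refl _ hd) (ih _ ?_ fun y hy => ?_)
      · rw [Matrix.transpose_mul, transpose_householder, Matrix.mul_assoc,
          ← Matrix.mul_assoc (householder _), hS, Matrix.one_mul, hU]
      · rw [← Matrix.mulVec_mulVec]
        by_cases hyx : y = x
        · rw [hyx, ← ha, householder_sub_mulVec (hiso b b) hd]
        · have hUy := h y (by simp [hy, hyx])
          -- As `U` preserves scalar products and fixes `e_y`, the products of `a` and `b` with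
          -- `e_y` agree; hence the reflection still fixes `e_y`.
          have h0 : (a - b) ⬝ᵥ Pi.single y 1 = 0 := by
            have := hiso b (Pi.single y 1)
            rw [hUy] at this
            rw [sub_dotProduct, ← this, sub_self]
          rw [hUy, householder_mulVec, h0, mul_zero, zero_smul, sub_zero]

end Householder

theorem isRealizable_orthogonal {U : Matrix (ι → Bool) (ι → Bool) ℝ}
    (hU : U ∈ Matrix.orthogonalGroup (ι → Bool) ℝ) : IsRealizable (lift U) := by
  refine orthogonal_induction (p := fun M => IsRealizable (lift M)) ?_ ?_ ?_
    ((Matrix.mem_orthogonalGroup_iff' _ _).1 hU)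
  · rw [lift_one]; exact isRealizable_id
  · intro M N hM hN
    rw [lift_mul]
    exact hM.comp hN
  · exact fun d hd => isRealizable_householder hd

/-- A pattern with `n` outputs, as a measured open graph. -/
def toMeasuredOpenGraph {V : Type} {n : ℕ} (P : Pattern V n (Fin n)) : MeasuredOpenGraph V n :=
  ⟨P.graph, P.input, P.output, P.meas⟩

theorem exists_simulates_orthogonal (n : ℕ) {U : Matrix (Fin n → Bool) (Fin n → Bool) ℝ}
    (hU : U ∈ Matrix.orthogonalGroup (Fin n → Bool) ℝ) :
    ∃ (m : ℕ) (P : MeasuredOpenGraph (Fin m) n),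
      P.IsXZ ∧ P.Simulates (U.map (fun r : ℝ => (r : ℂ))) := by
  obtain ⟨m, P, hXZ, hP⟩ := isRealizable_orthogonal hU n _ _ _ _ ((XZ_start n).prepare measX)
    ((realizes_start n).prepare measX)
  obtain ⟨h00, h01, h10, h11⟩ := xz_bra 0
  simp only [zero_div, Real.cos_zero, Real.sin_zero, Complex.ofReal_one, Complex.ofReal_zero]
    at h00 h01 h10 h11
  have hval : ∀ (x y : Fin n → Bool) (b : Bool),
      lift U (fun w => basisState x (w ∘ some)) (fun o => o.elim b y) = (U y x : ℂ) := by
    intro x y b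
    rw [lift, Finset.sum_eq_single x]
    · have : (fun o : Option (Fin n) => o.elim b x) ∘ some = x := rfl
      simp only [Option.elim_none, this, basisState, if_true, mul_one]
      rfl
    · intro w _ hw
      have : (fun o : Option (Fin n) => o.elim b w) ∘ some = w := rfl
      simp only [Option.elim_none, this, basisState, if_neg hw, mul_zero]
    · simp
  have hc : ∀ (β : Bool → ℂ) x, contract Function.Embedding.some none β
      (lift U (fun w => basisState x (w ∘ some))) = fun y => (β false + β true) * (U y x : ℂ) := by
    intro β x
    funext y
    rw [contract_some]
    simp only [hval, Fintype.sum_bool]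
    ring
  -- The idle ancilla is still in `|0⟩ + |1⟩`, so a `Z`-measurement detaches it without correction.
  -- The sign comes from the basis vector `-|1⟩` at angle 0.
  have hmeas := hP.measure Function.Embedding.some (k := none) (Measurement.xz 0) some_cover
    some_ne_none ∅ ∅ ⟨-1, by simp, fun x => by
      funext y
      simp [hc, h00, h01, h10, h11, pauliX_apply, pauliZ_apply, signOn, flip_empty]⟩
  have hXZ' := hXZ.measure Function.Embedding.some (k := none) (M := .xz 0) some_cover
    some_ne_none trivial (Or.inr (Or.inl rfl))
  simp only [hc, h00, h01, add_zero, one_mul] at hmeas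
  exact ⟨m, (P.measure Function.Embedding.some none (.xz 0)).toMeasuredOpenGraph,
    ⟨hXZ'.1, hXZ'.2.1⟩, MeasuredOpenGraph.simulates_of_realizes hmeas⟩

theorem isXZ_pathX (m : ℕ) : (pathX m).IsXZ := ⟨fun _ _ => trivial, fun _ _ => rfl⟩

theorem isXZ_edgeCZ : edgeCZ.IsXZ := ⟨fun _ _ => trivial, fun _ _ => rfl⟩

theorem isXZ_triangleXZ (α : ℝ) : (triangleXZ α).IsXZ :=
  ⟨fun v _ => by fin_cases v <;> trivial, fun _ _ => rfl⟩

end Pattern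
end OneWay

theorem mainTheorem3 :
    (∀ (n : ℕ) (U : Matrix (Fin n → Bool) (Fin n → Bool) ℝ),
      U ∈ Matrix.orthogonalGroup (Fin n → Bool) ℝ →
        ∃ (m : ℕ) (P : OneWay.MeasuredOpenGraph (Fin m) n),
          P.IsXZ ∧ P.Simulates (U.map (fun r : ℝ => (r : ℂ)))) ∧
    (∀ m : ℕ, Odd m → (OneWay.pathX m).IsXZ ∧ (OneWay.pathX m).Simulates OneWay.gateH) ∧
    (OneWay.edgeCZ.IsXZ ∧ OneWay.edgeCZ.Simulates OneWay.gateCZ) ∧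
    (∀ α : ℝ, (OneWay.pathXY α).Simulates (OneWay.gateP α) ∧
      (OneWay.triangleXZ α).graph = OneWay.localComplement (OneWay.pathXY α).graph 2 ∧
      (OneWay.triangleXZ α).IsXZ ∧ (OneWay.triangleXZ α).Simulates (OneWay.gateP α)) :=
  ⟨fun n _ hU => OneWay.Pattern.exists_simulates_orthogonal n hU,
    fun m hm => ⟨OneWay.Pattern.isXZ_pathX m, OneWay.Pattern.simulates_pathX hm⟩,
    ⟨OneWay.Pattern.isXZ_edgeCZ, OneWay.Pattern.simulates_edgeCZ⟩,
    fun α => ⟨OneWay.Pattern.simulates_pathXY α, rfl, OneWay.Pattern.isXZ_triangleXZ α,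
      OneWay.Pattern.simulates_triangleXZ α⟩⟩
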